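/- **Setting.** Let $\mathcal L$ be a finite set of agents, let $\mathcal X_0$ and $\mathcal X_l$ ($l\in\mathcal L$) be finite alphabets, and let $p$ be the law of $(X_{\mathcal L},X_0)$ on $\prod_l\mathcal X_l\times\mathcal X_0$. Assume the Markov chains $X_{\mathcal S}-X_0-X_{\mathcal T}$ for all disjoint $\mathcal S,\mathcal T\subseteq\mathcal L$. Agent $l$ observes $N$ i.i.d. copies $X_l^N$ and a base station observes $X_0^N$. Logarithms are to base $2$. **Strategies.** For $\mathcal S\subseteq\mathcal L$, a strategy in $\mathfrak S(\mathcal S)$ with rates $(R_i)_{i\in\mathcal S}$ is a sequence, indexed by $N$, of protocols of the following form. The agents in $\mathcal S$ and the base station communicate interactively, in finitely many rounds, over a noiseless public channel. The messages lie in a countable alphabet, and each is a function of the sender's observation, of independent local randomness with finitely many values (which may be absent), and of the previous messages. The whole public communication is $A_{\mathcal S}$. Then, for each $i\in\mathcal S$, agent $i$ computes a key $K_i(X_i^N,A_{\mathcal S})\in\mathcal K_i$ and the base station computes $\widehat K_i(X_0^N,A_{\mathcal S})\in\mathcal K_i$, where $\frac1N\log|\mathcal K_i|\to R_i$. Put $K_{\mathcal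 S}=(K_i)_{i\in\mathcal S}$, $\widehat K_{\mathcal S}=(\widehat K_i)_{i\in\mathcal S}$, $\mathcal K_{\mathcal S}=\prod_{i\in\mathcal S}\mathcal K_i$ and $\mathcal S^c=\mathcal L\setminus\mathcal S$. **Game.** If $\mathcal S$ plays $a_{\mathcal S}\in\mathfrak S(\mathcal S)$ and the other agents play $a_{\mathcal S^c}\in\mathfrak S(\mathcal S^c)$, then the total public communication $A$ consists of $A_{\mathcal S}$, followed by the messages of the agents in $\mathcal S^c$, who have heard $A_{\mathcal S}$. The base station is passive and sends nothing on behalf of $\mathcal S^c$. The payoff $\pi_i(a_{\mathcal S},a_{\mathcal S^c})$ of agent $i\in\mathcal S$ is its key rate $R_i$ if, as $N\to\infty$, $\mathbb P[\widehat K_{\mathcal S}\ne K_{\mathcal S}]\to0$, $I(K_{\mathcal S};A)\to0$ and $\log|\mathcal K_{\mathcal S}|-H(K_{\mathcal S})\to0$, and it is $0$ otherwise. The value function is $$v(\mathcal S)=\max_{a_{\mathcal S}\in\mathfrak S(\mathcal S)}\ \min_{a_{\mathcal S^c}\in\mathfrak S(\mathcal S^c)}\ \sum_{i\in\mathcal S}\pi_i(a_{\mathcal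 S},a_{\mathcal S^c}).$$ A rate tuple $(R_i)_{i\in\mathcal S}$ is called achievable by $\mathcal S$ if some strategy in $\mathfrak S(\mathcal S)$ with these rates satisfies $\mathbb P[\widehat K_{\mathcal S}\ne K_{\mathcal S}]\to0$, $I(K_{\mathcal S};A_{\mathcal S},X_{\mathcal S^c}^N)\to0$ and $\log|\mathcal K_{\mathcal S}|-H(K_{\mathcal S})\to0$, that is, the keys are secret from the other agents whatever these do. **Theorem.** For every coalition $\mathcal S\subseteq\mathcal L$, the maximum and the minima above are attained, and $$v(\mathcal S)=I(X_{\mathcal S};X_0\mid X_{\mathcal S^c}).$$ This number is also the largest sum-rate $\sum_{i\in\mathcal S}R_i$ of a rate tuple $(R_i)_{i\in\mathcal S}$ that is achievable by $\mathcal S$. -/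

import Mathlib

open Filter Topology

noncomputable section

namespace SecretKeyGame

/-! ### Finite probability: laws and Shannon information in bits

A finite probability space is a finite type `Ω` with weights `w : Ω → ℝ`; a random variable is a
function on `Ω`, with values in an arbitrary type. -/

section Information

variable {Ω α β γ : Type*} [Fintype Ω]

open Classical in
/-- The probability of the event `E`. -/
def prob (w : Ω → ℝ) (E : Ω → Prop) : ℝ := ∑ ω with E ω, w ω

open Classical in
/-- Shannon entropy `H(U)`, in bits; the sum runs over the (finite) range of `U`. -/
def entropy (w : Ω → ℝ) (U : Ω → α) : ℝ :=
  ∑ u ∈ Finset.univ.image U, Real.negMulLog (prob w fun ω => U ω = u) / Real.log 2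

/-- Mutual information `I(U; V)`. -/
def mutualInfo (w : Ω → ℝ) (U : Ω → α) (V : Ω → β) : ℝ :=
  entropy w U + entropy w V - entropy w fun ω => (U ω, V ω)

/-- Conditional mutual information `I(U; V | W)`. -/
def condMutualInfo (w : Ω → ℝ) (U : Ω → α) (V : Ω → β) (W : Ω → γ) : ℝ :=
  entropy w (fun ω => (U ω, W ω)) + entropy w (fun ω => (V ω, W ω))
    - entropy w (fun ω => (U ω, V ω, W ω)) - entropy w W

/-- The Markov chain `U - V - W`: given `V`, the variables `U` and `W` are independent. -/
def IsMarkovChain (w : Ω → ℝ) (U : Ω → α) (V : Ω → β) (W : Ω → γ) : Prop :=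
  ∀ a b c,
    prob w (fun ω => U ω = a ∧ V ω = b ∧ W ω = c) * prob w (fun ω => V ω = b) =
      prob w (fun ω => U ω = a ∧ V ω = b) * prob w (fun ω => V ω = b ∧ W ω = c)

end Information

variable {ι : Type*} [Fintype ι] [DecidableEq ι] {X : ι → Type*} [∀ i, Fintype (X i)]
  {X₀ : Type*} [Fintype X₀]

/-! ### The source -/

/-- One use of the source: the symbols `(x_l)_l` of the agents and the symbol `x_0` of the base
station. -/
abbrev Symbol {ι : Type*} (X : ι → Type*) (X₀ : Type*) := (∀ i, X i) × X₀

/-- The components `X_S` of a source symbol. -/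
def agentsPart (S : Finset ι) (x : Symbol X X₀) : ∀ i : S, X i := fun i => x.1 i

/-- The law of a single source symbol, as real weights. -/
def sourceWeight (p : PMF (Symbol X X₀)) (x : Symbol X X₀) : ℝ := (p x).toReal

/-- The source satisfies `X_S - X_0 - X_T` for all disjoint `S` and `T`. -/
def MarkovSource (p : PMF (Symbol X X₀)) : Prop :=
  ∀ S T : Finset ι, Disjoint S T →
    IsMarkovChain (sourceWeight p) (agentsPart S) (fun x => x.2) (agentsPart T)

/-- `I(X_S; X_0 | X_{Sᶜ})`. -/
def sourceInfo (p : PMF (Symbol X X₀)) (S : Finset ι) : ℝ :=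
  condMutualInfo (sourceWeight p) (agentsPart S) (fun x => x.2) (agentsPart Sᶜ)

/-- The observation `X_i^N` of agent `i`. -/
def agentObs {N : ℕ} (x : Fin N → Symbol X X₀) (i : ι) : Fin N → X i := fun t => (x t).1 i

/-- The observation `X_0^N` of the base station. -/
def baseObs {N : ℕ} (x : Fin N → Symbol X X₀) : Fin N → X₀ := fun t => (x t).2

/-! ### Strategies -/

/-- What has been said over the public channel: for every round, the message of every party.
The party `none` is the base station, the party `some i` is agent `i`. Messages are natural
numbers, so that every countable message alphabet is covered; being silent is sending `0`. -/
abbrev Transcript (ι : Type*) := List (Option ι → ℕ)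

/-- A secret-key generation strategy for the coalition `S` at block length `N`. In every round, the
base station and every agent in `S` send a message, computed from their own observation, their own
local randomness and all that has been said before. At the end, agent `i` in `S` and the base
station compute their versions of the key of agent `i` from their own observation and the public
communication. The case of deterministic protocols is `seeds = 1`. -/
structure BlockStrategy {ι : Type*} (X : ι → Type*) (X₀ : Type*) (S : Finset ι) (N : ℕ) where
  /-- The key of agent `i` takes values in a set of this size. -/
  keySize : S → ℕ
  keySize_pos : ∀ i, 0 < keySize i
  /-- The local randomness of each party takes values in `Fin seeds` and has law `seedLaw`. -/
  seeds : ℕ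
  seedLaw : Option ι → PMF (Fin seeds)
  rounds : ℕ
  agentMsg : ∀ i : S, (Fin N → X i) → Fin seeds → Transcript ι → ℕ
  baseMsg : (Fin N → X₀) → Fin seeds → Transcript ι → ℕ
  key : ∀ i : S, (Fin N → X i) → Transcript ι → Fin (keySize i)
  baseKey : ∀ i : S, (Fin N → X₀) → Transcript ι → Fin (keySize i)

namespace BlockStrategy

variable {S : Finset ι} {N : ℕ}

/-- The messages of the next round, after the transcript `h`; the base station takes part if
`base` is true and is silent otherwise. Parties outside the coalition say nothing. -/
def nextRound (a : BlockStrategy X X₀ S N) (base : Bool) (x : Fin N → Symbol X X₀)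
    (q : Option ι → Fin a.seeds) (h : Transcript ι) : Option ι → ℕ
  | none => if base then a.baseMsg (baseObs x) (q none) h else 0
  | some i => if hi : i ∈ S then a.agentMsg ⟨i, hi⟩ (agentObs x i) (q (some i)) h else 0

/-- The transcript after `n` further rounds, if `h` has been said before. -/
def run (a : BlockStrategy X X₀ S N) (base : Bool) (x : Fin N → Symbol X X₀)
    (q : Option ι → Fin a.seeds) (h : Transcript ι) : ℕ → Transcript ι
  | 0 => h
  | n + 1 => a.run base x q h n ++ [a.nextRound base x q (a.run base x q h n)]

/-- The public communication `A_S` between the agents in `S` and the base station. -/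
def publicComm (a : BlockStrategy X X₀ S N) (x : Fin N → Symbol X X₀)
    (q : Option ι → Fin a.seeds) : Transcript ι :=
  a.run true x q [] a.rounds

/-- The keys `K_S` of the agents in `S`. -/
def keys (a : BlockStrategy X X₀ S N) (x : Fin N → Symbol X X₀) (q : Option ι → Fin a.seeds) :
    ∀ i : S, Fin (a.keySize i) :=
  fun i => a.key i (agentObs x i) (a.publicComm x q)

/-- The keys computed by the base station for the agents in `S`. -/
def baseKeys (a : BlockStrategy X X₀ S N) (x : Fin N → Symbol X X₀)
    (q : Option ι → Fin a.seeds) : ∀ i : S, Fin (a.keySize i) :=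
  fun i => a.baseKey i (baseObs x) (a.publicComm x q)

/-- `log |K_S|`, in bits. -/
def logKeys (a : BlockStrategy X X₀ S N) : ℝ := Real.logb 2 (∏ i, a.keySize i : ℕ)

/-- The law of the local randomness: independent parties. -/
def seedWeight (a : BlockStrategy X X₀ S N) (q : Option ι → Fin a.seeds) : ℝ :=
  ∏ j, (a.seedLaw j (q j)).toReal

/-- The joint law of the `N` independent source symbols and the local randomness. -/
def weight (p : PMF (Symbol X X₀)) (a : BlockStrategy X X₀ S N)
    (ω : (Fin N → Symbol X X₀) × (Option ι → Fin a.seeds)) : ℝ :=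
  (∏ t, sourceWeight p (ω.1 t)) * a.seedWeight ω.2

/-- The observations `X_{Sᶜ}^N` of the agents outside `S`. -/
def outsideObs (S : Finset ι) {N : ℕ} (x : Fin N → Symbol X X₀) :
    ∀ i : (Sᶜ : Finset ι), Fin N → X i := fun i => agentObs x i

/-- The probability that some key of the coalition is not recovered by the base station. -/
def errorProb (p : PMF (Symbol X X₀)) (a : BlockStrategy X X₀ S N) : ℝ :=
  prob (a.weight p) fun ω => a.baseKeys ω.1 ω.2 ≠ a.keys ω.1 ω.2

/-- `log |K_S| - H(K_S)`. -/
def uniformityGap (p : PMF (Symbol X X₀)) (a : BlockStrategy X X₀ S N) : ℝ :=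
  a.logKeys - entropy (a.weight p) fun ω => a.keys ω.1 ω.2

/-- `I(K_S; A_S, X_{Sᶜ}^N)`. -/
def leakage (p : PMF (Symbol X X₀)) (a : BlockStrategy X X₀ S N) : ℝ :=
  mutualInfo (a.weight p) (fun ω => a.keys ω.1 ω.2)
    fun ω => (a.publicComm ω.1 ω.2, outsideObs S ω.1)

/-- Everything that is said publicly if `S` plays `a` and the other agents play `b`. The other
agents have heard all of `A_S` when they speak. The base station follows the protocol of `S` and
does not speak on behalf of the other agents. -/
def jointComm (a : BlockStrategy X X₀ S N) (b : BlockStrategy X X₀ Sᶜ N)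
    (x : Fin N → Symbol X X₀) (q : Option ι → Fin a.seeds) (q' : Option ι → Fin b.seeds) :
    Transcript ι :=
  b.run false x q' (a.publicComm x q) b.rounds

/-- The information `I(K_S; A)` about the keys of `S` in the whole public communication `A`, if `S`
plays `a` and the other agents play `b`. The local randomness of `a` and that of `b` are
independent. -/
def jointLeakage (p : PMF (Symbol X X₀)) (a : BlockStrategy X X₀ S N)
    (b : BlockStrategy X X₀ Sᶜ N) : ℝ :=
  mutualInfo
    (fun ω : ((Fin N → Symbol X X₀) × (Option ι → Fin a.seeds)) × (Option ι → Fin b.seeds) =>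
      a.weight p ω.1 * b.seedWeight ω.2)
    (fun ω => a.keys ω.1.1 ω.1.2) (fun ω => a.jointComm b ω.1.1 ω.1.2 ω.2)

end BlockStrategy

/-- A strategy that the coalition `S` can adopt: a sequence, in the block length `N`, of secret-key
generation strategies, where the key alphabet of agent `i` has size `2 ^ (N * R_i)` to first order in
the exponent. -/
structure Strategy {ι : Type*} (X : ι → Type*) (X₀ : Type*) (S : Finset ι) where
  block : ∀ N, BlockStrategy X X₀ S N
  rate : S → ℝ
  rate_tendsto : ∀ i, Tendsto (fun N : ℕ => Real.logb 2 ((block N).keySize i) / N) atTop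
    (𝓝 (rate i))

/-! ### Achievable rates of a coalition -/

/-- The rate tuple `(R_i)` is achievable by the coalition `S`: reliability, collective secrecy with
respect to the public communication and the observations of all the other agents, uniformity. -/
def Achievable (p : PMF (Symbol X X₀)) (S : Finset ι) (R : S → ℝ) : Prop :=
  ∃ a : Strategy X X₀ S, a.rate = R ∧
    Tendsto (fun N => (a.block N).errorProb p) atTop (𝓝 0) ∧
    Tendsto (fun N => (a.block N).leakage p) atTop (𝓝 0) ∧
    Tendsto (fun N => (a.block N).uniformityGap p) atTop (𝓝 0)

/-! ### The game -/

/-- If `S` plays `a` and the other agents play `b`, the keys of `S` are secret keys: they are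
reliable, secret from the whole public communication, and uniform. -/
def GivesSecretKeys (p : PMF (Symbol X X₀)) {S : Finset ι} (a : Strategy X X₀ S)
    (b : Strategy X X₀ Sᶜ) : Prop :=
  Tendsto (fun N => (a.block N).errorProb p) atTop (𝓝 0) ∧
  Tendsto (fun N => (a.block N).jointLeakage p (b.block N)) atTop (𝓝 0) ∧
  Tendsto (fun N => (a.block N).uniformityGap p) atTop (𝓝 0)

open Classical in
/-- The payoff of agent `i` in `S`, the rate of its secret key; it is `0` if the keys of the
coalition are not secret keys. -/
def payoff (p : PMF (Symbol X X₀)) {S : Finset ι} (a : Strategy X X₀ S) (b : Strategy X X₀ Sᶜ)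
    (i : S) : ℝ :=
  if GivesSecretKeys p a b then a.rate i else 0

/-- The sum-rate that `S` secures with `a` whatever the other agents do. -/
def guaranteed (p : PMF (Symbol X X₀)) {S : Finset ι} (a : Strategy X X₀ S) : ℝ :=
  ⨅ b : Strategy X X₀ Sᶜ, ∑ i, payoff p a b i

/-- The value function of the game. -/
def value (p : PMF (Symbol X X₀)) (S : Finset ι) : ℝ :=
  ⨆ a : Strategy X X₀ S, guaranteed p a

end SecretKeyGame

end

noncomputable section

namespace SecretKeyGame

/-! ### Shannon information on finite probability spaces -/

section Shannon

variable {Ω Ω' α β γ δ : Type*} [Fintype Ω] [Fintype Ω']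

/-! The game reduces to secret-key generation against an eavesdropper who holds $X_{S^c}^N$.
Whatever the other agents say is a function of $A_S$, $X_{S^c}^N$ and independent seeds, so by data
processing it reveals no more than $X_{S^c}^N$ itself (`jointLeakage_le_leakage`). If they publish
all their observations, that bound is met exactly (`jointLeakage_reveal`). The minimum over
opponents exists because the payoff sum takes at most two values for a given strategy of $S$.

Converse (`sum_rate_le`): treat the agents of $S$ as one terminal and the base station as the other.
Every message is computed by one terminal from what it knows and what was said, so public discussion
cannot raise the mutual information of the terminals given the discussion and $X_{S^c}^N$. Initially
this information is $N\,I(X_S;X_0\mid X_{S^c})$. Fano's inequality bounds the key length by it, up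
to leakage, nonuniformity and an error term, which vanish after division by $N$.

Achievability (`exists_strategy`): order $S$ and let $T_i$ be $S^c$ together with the predecessors
of $i$. Agent $i$ applies one hash to $X_i^N$, announces the first component as a bin index and
keeps the second as its key. A bin rate just above $H(X_i\mid X_0)$ lets the base station decode by
Slepian-Wolf coding; a total rate just below $H(X_i\mid X_{T_i})$ makes the whole hash nearly
uniform given $X_{T_i}^N$. By the chain rule all the hashes are jointly nearly uniform given
$X_{S^c}^N$, which gives both secrecy and uniformity. The Markov assumption gives $H(X_i\mid
X_0)=H(X_i\mid X_0,X_{T_i})$, so the key rates approach $I(X_i;X_0\mid X_{T_i})$, and these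
telescope to the claimed value. -/

/-- The weights `w` are those of a probability law. -/
structure IsLaw (w : Ω → ℝ) : Prop where
  nonneg : ∀ ω, 0 ≤ w ω
  sum_eq_one : ∑ ω, w ω = 1

theorem IsLaw.nonempty {w : Ω → ℝ} (hw : IsLaw w) : Nonempty Ω := by
  by_contra h
  rw [not_nonempty_iff] at h
  simpa using hw.sum_eq_one

open Classical in
theorem prob_eq_sum_ite (w : Ω → ℝ) (E : Ω → Prop) : prob w E = ∑ ω, if E ω then w ω else 0 := by
  rw [prob, Finset.sum_filter]

theorem prob_congr (w : Ω → ℝ) {E F : Ω → Prop} (h : ∀ ω, E ω ↔ F ω) : prob w E = prob w F := by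
  rw [show E = F from funext fun ω => propext (h ω)]

theorem prob_nonneg {w : Ω → ℝ} (hw : IsLaw w) (E : Ω → Prop) : 0 ≤ prob w E :=
  Finset.sum_nonneg fun ω _ => hw.nonneg ω

theorem prob_mono {w : Ω → ℝ} (hw : IsLaw w) {E F : Ω → Prop} (h : ∀ ω, E ω → F ω) :
    prob w E ≤ prob w F := by
  classical
  exact Finset.sum_le_sum_of_subset_of_nonneg
    (fun ω => by simpa using h ω) fun ω _ _ => hw.nonneg ω

theorem le_prob {w : Ω → ℝ} (hw : IsLaw w) {E : Ω → Prop} {ω : Ω} (h : E ω) : w ω ≤ prob w E := by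
  classical
  exact Finset.single_le_sum (f := w) (fun ω _ => hw.nonneg ω) (by simpa using h)

theorem prob_pos {w : Ω → ℝ} (hw : IsLaw w) {E : Ω → Prop} {ω : Ω} (h : E ω) (hω : 0 < w ω) :
    0 < prob w E := hω.trans_le (le_prob hw h)

theorem prob_eq_pos {w : Ω → ℝ} (hw : IsLaw w) (U : Ω → α) {ω : Ω} (hω : 0 < w ω) :
    0 < prob w fun ω' => U ω' = U ω := prob_pos hw (E := fun ω' => U ω' = U ω) rfl hω

theorem prob_exists_le {κ : Type*} [Fintype κ] {w : Ω → ℝ} (hw : IsLaw w) (E : κ → Ω → Prop) :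
    prob w (fun ω => ∃ k, E k ω) ≤ ∑ k, prob w (E k) := by
  classical
  simp only [prob_eq_sum_ite]
  rw [Finset.sum_comm]
  refine Finset.sum_le_sum fun ω _ => ?_
  have hn : ∀ k ∈ Finset.univ, (0 : ℝ) ≤ if E k ω then w ω else 0 := fun k _ => by
    split_ifs
    exacts [hw.nonneg ω, le_rfl]
  split_ifs with h
  · obtain ⟨k, hk⟩ := h
    simpa [hk] using Finset.single_le_sum hn (Finset.mem_univ k)
  · exact Finset.sum_nonneg hn

theorem sum_mul_comp [DecidableEq α] (w : Ω → ℝ) (U : Ω → α) (g : α → ℝ) :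
    ∑ ω, w ω * g (U ω) = ∑ u ∈ Finset.univ.image U, prob w (fun ω => U ω = u) * g u := by
  rw [← Finset.sum_fiberwise_of_maps_to (g := U) (t := Finset.univ.image U)
    fun ω _ => Finset.mem_image_of_mem U (Finset.mem_univ ω)]
  refine Finset.sum_congr rfl fun u _ => ?_
  rw [prob, Finset.sum_mul]
  refine Finset.sum_congr (by congr!) fun ω hω => ?_
  simp only [Finset.mem_filter] at hω
  rw [hω.2]

/-- Entropy as an expectation over `Ω` instead of a sum over the range of `U`: entropies of
different variables can then be compared termwise. -/
theorem entropy_eq_sum (w : Ω → ℝ) (U : Ω → α) :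
    entropy w U = -∑ ω, w ω * Real.logb 2 (prob w fun ω' => U ω' = U ω) := by
  classical
  rw [sum_mul_comp w U fun u => Real.logb 2 (prob w fun ω' => U ω' = u), entropy,
    ← Finset.sum_neg_distrib]
  refine Finset.sum_congr (by congr!) fun u _ => ?_
  rw [Real.negMulLog, Real.logb]
  ring

open Classical in
theorem sum_prob_eq_one {w : Ω → ℝ} (hw : IsLaw w) (U : Ω → α) :
    ∑ u ∈ Finset.univ.image U, prob w (fun ω => U ω = u) = 1 := by
  simpa [hw.sum_eq_one] using (sum_mul_comp w U fun _ => 1).symm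

open Classical in
theorem sum_prob_and (w : Ω → ℝ) (U : Ω → α) (E : Ω → Prop) :
    ∑ u ∈ Finset.univ.image U, prob w (fun ω => U ω = u ∧ E ω) = prob w E := by
  have h := sum_mul_comp (fun ω => if E ω then w ω else 0) U fun _ => 1
  simp only [mul_one] at h
  rw [prob_eq_sum_ite w E, h]
  refine Finset.sum_congr rfl fun u _ => ?_
  simp only [prob_eq_sum_ite]
  refine Finset.sum_congr rfl fun ω _ => ?_
  by_cases h1 : U ω = u <;> simp [h1]

/-- Entropy sees only the partition of `Ω` into fibres. All regrouping of tuples and removal of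
determined components below goes through this. -/
theorem entropy_congr (w : Ω → ℝ) {U : Ω → α} {V : Ω → β}
    (h : ∀ ω ω', U ω = U ω' ↔ V ω = V ω') : entropy w U = entropy w V := by
  simp only [entropy_eq_sum, h]

theorem entropy_mono {w : Ω → ℝ} (hw : IsLaw w) {U : Ω → α} {V : Ω → β}
    (h : ∀ ω ω', V ω = V ω' → U ω = U ω') : entropy w U ≤ entropy w V := by
  rw [entropy_eq_sum, entropy_eq_sum]
  refine neg_le_neg (Finset.sum_le_sum fun ω _ => ?_)
  rcases (hw.nonneg ω).eq_or_lt with h0 | h0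
  · simp [← h0]
  · exact mul_le_mul_of_nonneg_left (Real.logb_le_logb_of_le one_lt_two
      (prob_eq_pos hw V h0) (prob_mono hw fun ω' => h ω' ω)) h0.le

open Classical in
/-- Gibbs' inequality for conditional entropy. -/
theorem condEntropy_le_crossEntropy {w : Ω → ℝ} (hw : IsLaw w) (U : Ω → α) (V : Ω → β)
    (q : α → β → ℝ) (hq : ∀ u v, 0 ≤ q u v) (hpos : ∀ ω, 0 < w ω → 0 < q (U ω) (V ω))
    (hsum : ∀ v, ∑ u ∈ Finset.univ.image U, q u v ≤ 1) :
    entropy w (fun ω => (U ω, V ω)) - entropy w V ≤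
      -∑ ω, w ω * Real.logb 2 (q (U ω) (V ω)) := by
  set P : α × β → ℝ := fun x => prob w fun ω => (U ω, V ω) = x
  set Q : β → ℝ := fun v => prob w fun ω => V ω = v
  -- This is `log x ≤ x - 1` at the likelihood ratio `x = q Q / P`; points of weight zero contribute
  -- nothing.
  have hterm : ∀ ω, w ω * (Real.logb 2 (q (U ω) (V ω)) + Real.logb 2 (Q (V ω))
      - Real.logb 2 (P (U ω, V ω))) ≤
      w ω * ((q (U ω) (V ω) * Q (V ω) / P (U ω, V ω) - 1) / Real.log 2) := by
    intro ω
    rcases (hw.nonneg ω).eq_or_lt with h0 | h0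
    · simp [← h0]
    · have h1 := hpos ω h0
      have h2 : 0 < Q (V ω) := prob_pos hw rfl h0
      have h3 : 0 < P (U ω, V ω) := prob_pos hw rfl h0
      refine mul_le_mul_of_nonneg_left ?_ h0.le
      rw [← Real.logb_mul h1.ne' h2.ne', ← Real.logb_div (by positivity) h3.ne', Real.logb]
      exact div_le_div_of_nonneg_right (Real.log_le_sub_one_of_pos (by positivity))
        (Real.log_nonneg one_le_two)
  have hle : ∑ ω, w ω * (q (U ω) (V ω) * Q (V ω) / P (U ω, V ω)) ≤ 1 := by
    have h := sum_mul_comp w (fun ω => (U ω, V ω)) fun x => q x.1 x.2 * Q x.2 / P x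
    rw [h]
    calc ∑ x ∈ Finset.univ.image (fun ω => (U ω, V ω)), P x * (q x.1 x.2 * Q x.2 / P x)
      _ ≤ ∑ x ∈ Finset.univ.image (fun ω => (U ω, V ω)), q x.1 x.2 * Q x.2 := by
          refine Finset.sum_le_sum fun x _ => ?_
          have hx : 0 ≤ q x.1 x.2 * Q x.2 := mul_nonneg (hq _ _) (prob_nonneg hw _)
          rcases eq_or_ne (P x) 0 with h0 | h0
          · simp only [h0, div_zero, mul_zero]
            exact hx
          · exact (mul_div_cancel₀ _ h0).le
      _ ≤ ∑ x ∈ Finset.univ.image U ×ˢ Finset.univ.image V, q x.1 x.2 * Q x.2 := by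
          refine Finset.sum_le_sum_of_subset_of_nonneg ?_
            fun x _ _ => mul_nonneg (hq _ _) (prob_nonneg hw _)
          intro x hx
          obtain ⟨ω, -, rfl⟩ := Finset.mem_image.1 hx
          simp
      _ = ∑ v ∈ Finset.univ.image V, (∑ u ∈ Finset.univ.image U, q u v) * Q v := by
          rw [Finset.sum_product_right]
          simp only [Finset.sum_mul]
      _ ≤ ∑ v ∈ Finset.univ.image V, 1 * Q v :=
          Finset.sum_le_sum fun v _ => mul_le_mul_of_nonneg_right (hsum v) (prob_nonneg hw _)
      _ = 1 := by simpa using sum_prob_eq_one hw V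
  have h1 := Finset.sum_le_sum fun ω (_ : ω ∈ Finset.univ) => hterm ω
  have h2 : ∑ ω, w ω * ((q (U ω) (V ω) * Q (V ω) / P (U ω, V ω) - 1) / Real.log 2) ≤ 0 := by
    have : ∑ ω, w ω * ((q (U ω) (V ω) * Q (V ω) / P (U ω, V ω) - 1) / Real.log 2) =
        (∑ ω, w ω * (q (U ω) (V ω) * Q (V ω) / P (U ω, V ω)) - ∑ ω, w ω) / Real.log 2 := by
      rw [← Finset.sum_sub_distrib, Finset.sum_div]
      exact Finset.sum_congr rfl fun ω _ => by ring
    rw [this, hw.sum_eq_one]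
    exact div_nonpos_of_nonpos_of_nonneg (by linarith) (Real.log_nonneg one_le_two)
  simp only [mul_sub, mul_add, Finset.sum_sub_distrib, Finset.sum_add_distrib] at h1
  rw [entropy_eq_sum, entropy_eq_sum w V]
  simp only [P, Q] at h1 h2
  linarith

/-- Conditioning on more does not increase the entropy. -/
theorem entropy_submodular {w : Ω → ℝ} (hw : IsLaw w) (U : Ω → α) (V : Ω → β) (W : Ω → γ) :
    entropy w (fun ω => (U ω, V ω, W ω)) + entropy w W ≤
      entropy w (fun ω => (U ω, W ω)) + entropy w fun ω => (V ω, W ω) := by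
  classical
  -- Gibbs' inequality with the conditional law of `U` given `W` alone as comparison law; its cross
  -- entropy is `H(U | W)`.
  have h := condEntropy_le_crossEntropy hw U (fun ω => (V ω, W ω))
    (fun u x => prob w (fun ω => U ω = u ∧ W ω = x.2) / prob w fun ω => W ω = x.2)
    (fun _ _ => div_nonneg (prob_nonneg hw _) (prob_nonneg hw _))
    (fun ω h0 => div_pos (prob_pos hw ⟨rfl, rfl⟩ h0) (prob_pos hw rfl h0))
    (fun x => by
      rw [← Finset.sum_div, sum_prob_and w U fun ω => W ω = x.2]
      exact div_self_le_one _)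
  have h2 : ∑ ω, w ω * Real.logb 2 (prob w (fun ω' => U ω' = U ω ∧ W ω' = W ω) /
      prob w fun ω' => W ω' = W ω) = entropy w W - entropy w fun ω => (U ω, W ω) := by
    rw [entropy_eq_sum, entropy_eq_sum, neg_sub_neg, ← Finset.sum_sub_distrib]
    refine Finset.sum_congr rfl fun ω _ => ?_
    rcases (hw.nonneg ω).eq_or_lt with h0 | h0
    · simp [← h0]
    · have h1 : 0 < prob w fun ω' => U ω' = U ω ∧ W ω' = W ω :=
        prob_pos hw (E := fun ω' => U ω' = U ω ∧ W ω' = W ω) ⟨rfl, rfl⟩ h0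
      rw [Real.logb_div h1.ne' (prob_eq_pos hw W h0).ne', mul_sub]
      simp only [Prod.mk.injEq]
  simp only at h
  linarith

theorem condMutualInfo_nonneg {w : Ω → ℝ} (hw : IsLaw w) (U : Ω → α) (V : Ω → β) (W : Ω → γ) :
    0 ≤ condMutualInfo w U V W := by
  have := entropy_submodular hw U V W
  rw [condMutualInfo]
  linarith

theorem entropy_const {w : Ω → ℝ} (hw : IsLaw w) (c : α) : entropy w (fun _ => c) = 0 := by
  simp [entropy_eq_sum, prob, hw.sum_eq_one]

/-- Subadditivity of entropy. -/
theorem entropy_pair_le {w : Ω → ℝ} (hw : IsLaw w) (U : Ω → α) (V : Ω → β) :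
    entropy w (fun ω => (U ω, V ω)) ≤ entropy w U + entropy w V := by
  have h := entropy_submodular hw U V fun _ => ()
  rw [entropy_const hw, entropy_congr w (V := fun ω => (U ω, V ω)) (by simp),
    entropy_congr w (U := fun ω => (U ω, ())) (V := U) (by simp),
    entropy_congr w (U := fun ω => (V ω, ())) (V := V) (by simp)] at h
  linarith

theorem mutualInfo_nonneg {w : Ω → ℝ} (hw : IsLaw w) (U : Ω → α) (V : Ω → β) :
    0 ≤ mutualInfo w U V := by
  have := entropy_pair_le hw U V
  rw [mutualInfo]
  linarith

theorem entropy_le_logb_card [Fintype α] {w : Ω → ℝ} (hw : IsLaw w) (U : Ω → α) :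
    entropy w U ≤ Real.logb 2 (Fintype.card α) := by
  classical
  obtain ⟨ω₀⟩ := hw.nonempty
  have hc : 0 < (Fintype.card α : ℝ) := by
    exact_mod_cast Fintype.card_pos_iff.2 ⟨U ω₀⟩
  have h := condEntropy_le_crossEntropy hw U (fun _ => ()) (fun _ _ => (Fintype.card α : ℝ)⁻¹)
    (fun _ _ => by positivity) (fun _ _ => by positivity) (fun _ => by
      rw [Finset.sum_const, nsmul_eq_mul, ← div_eq_mul_inv, div_le_one hc]
      exact_mod_cast Finset.card_le_univ _)
  rw [← Finset.sum_mul, hw.sum_eq_one, entropy_const hw,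
    entropy_congr w (U := fun ω => (U ω, ())) (V := U) (by simp), Real.logb_inv] at h
  linarith

/-- Fano's inequality. -/
theorem condEntropy_le_of_prob_ne [Fintype α] {w : Ω → ℝ} (hw : IsLaw w) (U V : Ω → α) :
    entropy w (fun ω => (U ω, V ω)) - entropy w V ≤
      1 + prob w (fun ω => V ω ≠ U ω) * Real.logb 2 (Fintype.card α) := by
  classical
  obtain ⟨ω₀⟩ := hw.nonempty
  have hc : 0 < (Fintype.card α : ℝ) := by
    exact_mod_cast Fintype.card_pos_iff.2 ⟨U ω₀⟩
  -- The comparison law puts mass 1/2 on `u = v` and 1/(2|α|) on every other value. A correct guess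
  -- then costs one bit, a wrong one `1 + log |α|` bits.
  have h := condEntropy_le_crossEntropy hw U V
    (fun u v => if v ≠ u then (2 * Fintype.card α : ℝ)⁻¹ else 2⁻¹)
    (fun _ _ => by positivity) (fun _ _ => by split_ifs <;> positivity) (fun v => by
      calc _ ≤ ∑ u : α, if v ≠ u then (2 * Fintype.card α : ℝ)⁻¹ else 2⁻¹ :=
            Finset.sum_le_sum_of_subset_of_nonneg (Finset.subset_univ _)
              fun _ _ _ => by positivity
        _ ≤ ∑ u : α, ((2 * Fintype.card α : ℝ)⁻¹ + if v = u then 2⁻¹ else 0) := by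
            refine Finset.sum_le_sum fun u _ => ?_
            by_cases hvu : v = u <;> simp [hvu]
        _ = 1 := by
            rw [Finset.sum_add_distrib, Finset.sum_const, Finset.card_univ, nsmul_eq_mul]
            simp only [Finset.sum_ite_eq, Finset.mem_univ, if_true]
            field_simp
            norm_num)
  refine h.trans (le_of_eq ?_)
  have : ∀ ω, w ω * Real.logb 2 (if V ω ≠ U ω then (2 * Fintype.card α : ℝ)⁻¹ else 2⁻¹) =
      -(w ω + (if V ω ≠ U ω then w ω else 0) * Real.logb 2 (Fintype.card α)) := by
    intro ω
    split_ifs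
    · rw [Real.logb_inv, Real.logb_mul two_ne_zero hc.ne', Real.logb_self_eq_one one_lt_two]
      ring
    · rw [Real.logb_inv, Real.logb_self_eq_one one_lt_two]
      ring
  simp only [this, Finset.sum_neg_distrib, neg_neg, Finset.sum_add_distrib, hw.sum_eq_one,
    ← Finset.sum_mul, prob_eq_sum_ite]
  congr!

theorem condMutualInfo_eq_zero {w : Ω → ℝ} (hw : IsLaw w) {U : Ω → α} {V : Ω → β} {W : Ω → γ}
    (h : IsMarkovChain w U V W) : condMutualInfo w U W V = 0 := by
  have h' : ∀ ω, w ω * Real.logb 2 (prob w fun ω' => (U ω', W ω', V ω') = (U ω, W ω, V ω)) +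
      w ω * Real.logb 2 (prob w fun ω' => V ω' = V ω) =
      w ω * Real.logb 2 (prob w fun ω' => (U ω', V ω') = (U ω, V ω)) +
      w ω * Real.logb 2 (prob w fun ω' => (W ω', V ω') = (W ω, V ω)) := by
    intro ω
    rcases (hw.nonneg ω).eq_or_lt with h0 | h0
    · simp [← h0]
    · rw [← mul_add, ← mul_add,
        ← Real.logb_mul (prob_eq_pos hw (fun ω => (U ω, W ω, V ω)) h0).ne'
          (prob_eq_pos hw V h0).ne',
        ← Real.logb_mul (prob_eq_pos hw (fun ω => (U ω, V ω)) h0).ne'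
          (prob_eq_pos hw (fun ω => (W ω, V ω)) h0).ne']
      congr 2
      convert h (U ω) (V ω) (W ω) using 2 <;> refine prob_congr w fun ω' => ?_ <;>
        simp only [Prod.mk.injEq] <;> tauto
  have := Finset.sum_congr rfl fun ω (_ : ω ∈ Finset.univ) => h' ω
  simp only [Finset.sum_add_distrib] at this
  simp only [condMutualInfo, entropy_eq_sum]
  linarith

/-- What one side can compute from the conditioning can be added to the conditioning. -/
theorem condMutualInfo_le_of_determined {w : Ω → ℝ} (hw : IsLaw w) {U : Ω → α} {V : Ω → β}
    {W : Ω → γ} {f : Ω → δ} (hf : ∀ ω ω', U ω = U ω' → W ω = W ω' → f ω = f ω') :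
    condMutualInfo w U V (fun ω => (f ω, W ω)) ≤ condMutualInfo w U V W := by
  have h := entropy_submodular hw V f W
  rw [condMutualInfo, condMutualInfo,
    entropy_congr w (U := fun ω => (U ω, f ω, W ω)) (V := fun ω => (U ω, W ω)) (by
      intro ω ω'
      have := hf ω ω'
      simp only [Prod.mk.injEq]; tauto),
    entropy_congr w (U := fun ω => (U ω, V ω, f ω, W ω)) (V := fun ω => (U ω, V ω, W ω)) (by
      intro ω ω'
      have := hf ω ω'
      simp only [Prod.mk.injEq]; tauto)]
  linarith

theorem condMutualInfo_comm (w : Ω → ℝ) (U : Ω → α) (V : Ω → β) (W : Ω → γ) :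
    condMutualInfo w U V W = condMutualInfo w V U W := by
  rw [condMutualInfo, condMutualInfo,
    entropy_congr w (U := fun ω => (U ω, V ω, W ω)) (V := fun ω => (V ω, U ω, W ω)) (by
      intro ω ω'
      simp only [Prod.mk.injEq]; tauto)]
  ring

theorem condMutualInfo_congr (w : Ω → ℝ) (U : Ω → α) (V : Ω → β) {W : Ω → γ} {W' : Ω → δ}
    (h : ∀ ω ω', W ω = W ω' ↔ W' ω = W' ω') :
    condMutualInfo w U V W = condMutualInfo w U V W' := by
  simp only [condMutualInfo]
  congr 1
  · congr 1
    · congr 1 <;> exact entropy_congr w fun ω ω' => by simp only [Prod.mk.injEq, h]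
    · exact entropy_congr w fun ω ω' => by simp only [Prod.mk.injEq, h]
  · exact entropy_congr w h

/-- Secret key converse: a variable `K` known on one side and estimated as `L` on the other side
has, given `W`, not much more entropy than the mutual information of both sides. -/
theorem condEntropy_le_condMutualInfo_add [Fintype δ] {w : Ω → ℝ} (hw : IsLaw w) {U : Ω → α}
    {V : Ω → β} {W : Ω → γ} {K L : Ω → δ} (hK : ∀ ω ω', U ω = U ω' → W ω = W ω' → K ω = K ω')
    (hL : ∀ ω ω', V ω = V ω' → W ω = W ω' → L ω = L ω') :
    entropy w (fun ω => (K ω, W ω)) - entropy w W ≤ condMutualInfo w U V W +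
      (1 + prob w (fun ω => L ω ≠ K ω) * Real.logb 2 (Fintype.card δ)) := by
  -- Since `K` is a function of `(U, W)`, this says `H(K | W) ≤ I(U; V | W) + H(K | V, W)`. As `L`
  -- is a function of `(V, W)`, the last term is at most `H(K | L)`, to which Fano's inequality
  -- applies.
  have h1 := entropy_submodular hw U V fun ω => (K ω, W ω)
  have h2 := condEntropy_le_of_prob_ne hw K L
  have h3 := entropy_submodular hw K (fun ω => (V ω, W ω)) L
  rw [entropy_congr w (U := fun ω => (U ω, K ω, W ω)) (V := fun ω => (U ω, W ω)) (by
      intro ω ω'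
      have := hK ω ω'
      simp only [Prod.mk.injEq]; tauto),
    entropy_congr w (U := fun ω => (U ω, V ω, K ω, W ω)) (V := fun ω => (U ω, V ω, W ω)) (by
      intro ω ω'
      have := hK ω ω'
      simp only [Prod.mk.injEq]; tauto)] at h1
  rw [entropy_congr w (U := fun ω => ((V ω, W ω), L ω)) (V := fun ω => (V ω, W ω)) (by
      intro ω ω'
      have := hL ω ω'
      simp only [Prod.mk.injEq]; tauto),
    entropy_congr w (U := fun ω => (K ω, (V ω, W ω), L ω)) (V := fun ω => (V ω, K ω, W ω)) (by
      intro ω ω'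
      have := hL ω ω'
      simp only [Prod.mk.injEq]; tauto)] at h3
  rw [condMutualInfo]
  linarith

/-! ### Images and products of laws -/

open Classical in
/-- The map `φ` transports the law `w'` to the law `w`. -/
def MapsLaw (w' : Ω' → ℝ) (φ : Ω' → Ω) (w : Ω → ℝ) : Prop :=
  ∀ ω, ∑ ω' with φ ω' = ω, w' ω' = w ω

theorem MapsLaw.prob_comp {w' : Ω' → ℝ} {φ : Ω' → Ω} {w : Ω → ℝ} (h : MapsLaw w' φ w)
    (E : Ω → Prop) : prob w' (fun ω' => E (φ ω')) = prob w E := by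
  classical
  rw [prob_eq_sum_ite, prob_eq_sum_ite, ← Finset.sum_fiberwise (g := φ)]
  refine Finset.sum_congr rfl fun ω _ => ?_
  rw [← h ω]
  split_ifs with hE
  · exact Finset.sum_congr (by congr!) fun ω' hω' => by
      rw [(Finset.mem_filter.1 hω').2, if_pos hE]
  · exact Finset.sum_eq_zero fun ω' hω' => by rw [(Finset.mem_filter.1 hω').2, if_neg hE]

theorem MapsLaw.entropy_comp {w' : Ω' → ℝ} {φ : Ω' → Ω} {w : Ω → ℝ} (h : MapsLaw w' φ w)
    (U : Ω → α) : entropy w' (fun ω' => U (φ ω')) = entropy w U := by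
  classical
  have h2 : ∀ g : Ω → ℝ, ∑ ω', w' ω' * g (φ ω') = ∑ ω, w ω * g ω := by
    intro g
    rw [← Finset.sum_fiberwise (g := φ)]
    refine Finset.sum_congr rfl fun ω _ => ?_
    rw [← h ω, Finset.sum_mul]
    exact Finset.sum_congr (by congr!) fun ω' hω' => by rw [(Finset.mem_filter.1 hω').2]
  rw [entropy_eq_sum, entropy_eq_sum, ← h2]
  exact congrArg Neg.neg (Finset.sum_congr rfl fun ω' _ => by
    rw [h.prob_comp fun ω => U ω = U (φ ω')])

theorem IsLaw.prod {w : Ω → ℝ} {w' : Ω' → ℝ} (hw : IsLaw w) (hw' : IsLaw w') :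
    IsLaw fun x : Ω × Ω' => w x.1 * w' x.2 where
  nonneg x := mul_nonneg (hw.nonneg _) (hw'.nonneg _)
  sum_eq_one := by
    simp only [Fintype.sum_prod_type, ← Finset.mul_sum, hw'.sum_eq_one, mul_one, hw.sum_eq_one]

theorem mapsLaw_fst (w : Ω → ℝ) {w' : Ω' → ℝ} (hw' : IsLaw w') :
    MapsLaw (fun x : Ω × Ω' => w x.1 * w' x.2) Prod.fst w := by
  classical
  intro ω
  rw [Finset.sum_filter, Fintype.sum_prod_type, Finset.sum_eq_single ω]
  · simp [← Finset.mul_sum, hw'.sum_eq_one]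
  · intro ω' _ h
    simp [h]
  · simp

theorem prob_prod (w : Ω → ℝ) (w' : Ω' → ℝ) (E : Ω → Prop) (E' : Ω' → Prop) :
    prob (fun x : Ω × Ω' => w x.1 * w' x.2) (fun x => E x.1 ∧ E' x.2) = prob w E * prob w' E' := by
  classical
  simp only [prob_eq_sum_ite, Fintype.sum_prod_type, Finset.sum_mul_sum]
  refine Finset.sum_congr rfl fun ω _ => Finset.sum_congr rfl fun ω' _ => ?_
  by_cases h : E ω <;> by_cases h' : E' ω' <;> simp [h, h']

theorem entropy_prod {w : Ω → ℝ} {w' : Ω' → ℝ} (hw : IsLaw w) (hw' : IsLaw w') (U : Ω → α)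
    (V : Ω' → β) : entropy (fun x : Ω × Ω' => w x.1 * w' x.2) (fun x => (U x.1, V x.2)) =
      entropy w U + entropy w' V := by
  have key : ∀ ω ω', w ω * w' ω' * Real.logb 2 (prob (fun x : Ω × Ω' => w x.1 * w' x.2)
      fun x => (U x.1, V x.2) = (U ω, V ω')) =
      w' ω' * (w ω * Real.logb 2 (prob w fun x => U x = U ω)) +
        w ω * (w' ω' * Real.logb 2 (prob w' fun x => V x = V ω')) := by
    intro ω ω'
    simp only [Prod.mk.injEq, prob_prod w w' (fun x => U x = U ω) fun x => V x = V ω']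
    rcases (hw.nonneg ω).eq_or_lt with h0 | h0
    · simp [← h0]
    rcases (hw'.nonneg ω').eq_or_lt with h1 | h1
    · simp [← h1]
    rw [Real.logb_mul (prob_eq_pos hw U h0).ne' (prob_eq_pos hw' V h1).ne']
    ring
  rw [entropy_eq_sum, entropy_eq_sum, entropy_eq_sum, Fintype.sum_prod_type]
  simp only [key, Finset.sum_add_distrib, ← Finset.mul_sum, ← Finset.sum_mul, hw.sum_eq_one,
    hw'.sum_eq_one, one_mul]
  ring

/-! ### Finite products of laws -/

section Pi

variable {κ : Type*} [Fintype κ] {A B : κ → Type*} [∀ k, Fintype (A k)]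

theorem sum_pi_prod [DecidableEq κ] (f : ∀ k, A k → ℝ) :
    ∑ x : ∀ k, A k, ∏ k, f k (x k) = ∏ k, ∑ a, f k a := by
  rw [Finset.prod_univ_sum, Fintype.piFinset_univ]

theorem IsLaw.pi [DecidableEq κ] {w : ∀ k, A k → ℝ} (hw : ∀ k, IsLaw (w k)) :
    IsLaw fun x : ∀ k, A k => ∏ k, w k (x k) where
  nonneg x := Finset.prod_nonneg fun k _ => (hw k).nonneg _
  sum_eq_one := by simp [sum_pi_prod, (hw _).sum_eq_one]

theorem prob_pi [DecidableEq κ] (w : ∀ k, A k → ℝ) (E : ∀ k, A k → Prop) :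
    prob (fun x : ∀ k, A k => ∏ k, w k (x k)) (fun x => ∀ k, E k (x k)) =
      ∏ k, prob (w k) (E k) := by
  classical
  simp only [prob_eq_sum_ite]
  rw [← sum_pi_prod]
  refine Finset.sum_congr rfl fun x _ => ?_
  rw [Finset.prod_ite_zero]
  simp

theorem prob_pi_eq [DecidableEq κ] (w : ∀ k, A k → ℝ) (U : ∀ k, A k → B k) (u : ∀ k, B k) :
    prob (fun x : ∀ k, A k => ∏ k, w k (x k)) (fun x => (fun k => U k (x k)) = u) =
      ∏ k, prob (w k) fun a => U k a = u k := by
  rw [← prob_pi w fun k a => U k a = u k]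
  exact prob_congr _ fun x => funext_iff

/-- The logarithm of the product probability is a sum over coordinates. Its `k`-th term, weighted by
the law, is again a product over coordinates, so all factors but the `k`-th sum to 1. -/
theorem entropy_pi [DecidableEq κ] {w : ∀ k, A k → ℝ} (hw : ∀ k, IsLaw (w k))
    (U : ∀ k, A k → B k) :
    entropy (fun x : ∀ k, A k => ∏ k, w k (x k)) (fun x k => U k (x k)) =
      ∑ k, entropy (w k) (U k) := by
  have key : ∀ x : ∀ k, A k, (∏ k, w k (x k)) * Real.logb 2 (∏ k, prob (w k) fun a =>
      U k a = U k (x k)) = ∑ k, ∏ j, w j (x j) *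
        if j = k then Real.logb 2 (prob (w k) fun a => U k a = U k (x k)) else 1 := by
    intro x
    have : ∀ k, (∏ j, w j (x j) * if j = k then Real.logb 2 (prob (w k) fun a =>
        U k a = U k (x k)) else 1) = (∏ j, w j (x j)) * Real.logb 2 (prob (w k) fun a =>
        U k a = U k (x k)) := fun k => by
      rw [Finset.prod_mul_distrib]
      simp
    simp only [this]
    by_cases h0 : ∏ j, w j (x j) = 0
    · simp [h0]
    · rw [Real.logb_prod, Finset.mul_sum]
      intro k _
      refine (prob_eq_pos (hw k) (U k) (((hw k).nonneg _).lt_of_ne' fun h => h0 ?_)).ne'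
      exact Finset.prod_eq_zero (Finset.mem_univ k) h
  have key2 : ∀ k, ∑ x : ∀ k, A k, (∏ j, w j (x j) *
        if j = k then Real.logb 2 (prob (w k) fun a => U k a = U k (x k)) else 1) =
      ∑ a, w k a * Real.logb 2 (prob (w k) fun a' => U k a' = U k a) := by
    intro k
    rw [show ∑ x : ∀ k, A k, (∏ j, w j (x j) *
        if j = k then Real.logb 2 (prob (w k) fun a => U k a = U k (x k)) else 1) =
        ∑ x : ∀ k, A k, (∏ j, w j (x j) *
        if j = k then Real.logb 2 (prob (w j) fun a => U j a = U j (x j)) else 1) from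
      Finset.sum_congr rfl fun x _ => Finset.prod_congr rfl fun j _ => by
        by_cases hj : j = k
        · subst hj; rfl
        · simp [hj],
      sum_pi_prod fun j a => w j a *
        if j = k then Real.logb 2 (prob (w j) fun a' => U j a' = U j a) else 1,
      Finset.prod_eq_single k]
    · simp
    · intro j _ hj
      simp [hj, (hw j).sum_eq_one]
    · simp
  rw [entropy_eq_sum]
  simp only [prob_pi_eq, key]
  rw [Finset.sum_comm]
  simp only [key2, entropy_eq_sum, Finset.sum_neg_distrib]

end Pi

end Shannon

/-! ### Laws of the source and of block strategies -/

section Laws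

set_option linter.unusedSectionVars false

variable {ι : Type*} [Fintype ι] [DecidableEq ι] {X : ι → Type*} [∀ i, Fintype (X i)]
  {X₀ : Type*} [Fintype X₀]

theorem isLaw_toReal {Ω : Type*} [Fintype Ω] (p : PMF Ω) : IsLaw fun x => (p x).toReal where
  nonneg _ := ENNReal.toReal_nonneg
  sum_eq_one := by
    rw [← ENNReal.toReal_sum fun x _ => p.apply_ne_top x, ← tsum_fintype (L := .unconditional Ω),
      p.tsum_coe, ENNReal.toReal_one]

theorem isLaw_sourceWeight (p : PMF (Symbol X X₀)) : IsLaw (sourceWeight p) := isLaw_toReal p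

theorem agentsPart_eq_iff {S : Finset ι} {x y : Symbol X X₀} :
    agentsPart S x = agentsPart S y ↔ ∀ i ∈ S, x.1 i = y.1 i := by
  simp [agentsPart, funext_iff]

theorem agentObs_eq_iff {N : ℕ} {x y : Fin N → Symbol X X₀} {i : ι} :
    agentObs x i = agentObs y i ↔ ∀ t, (x t).1 i = (y t).1 i := funext_iff

theorem baseObs_eq_iff {N : ℕ} {x y : Fin N → Symbol X X₀} :
    baseObs x = baseObs y ↔ ∀ t, (x t).2 = (y t).2 := funext_iff

namespace BlockStrategy

variable {S : Finset ι} {N : ℕ}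

theorem outsideObs_eq_iff {x y : Fin N → Symbol X X₀} :
    outsideObs S x = outsideObs S y ↔ ∀ i ∈ Sᶜ, agentObs x i = agentObs y i := by
  simp [outsideObs, funext_iff]

theorem isLaw_seedWeight (a : BlockStrategy X X₀ S N) : IsLaw a.seedWeight :=
  IsLaw.pi fun j => isLaw_toReal (a.seedLaw j)

theorem isLaw_weight (p : PMF (Symbol X X₀)) (a : BlockStrategy X X₀ S N) :
    IsLaw (a.weight p) :=
  (IsLaw.pi fun _ => isLaw_sourceWeight p).prod a.isLaw_seedWeight

theorem isLaw_weight_mul (p : PMF (Symbol X X₀)) (a : BlockStrategy X X₀ S N)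
    (b : BlockStrategy X X₀ Sᶜ N) :
    IsLaw fun ω : ((Fin N → Symbol X X₀) × (Option ι → Fin a.seeds)) × (Option ι → Fin b.seeds) =>
      a.weight p ω.1 * b.seedWeight ω.2 :=
  (a.isLaw_weight p).prod b.isLaw_seedWeight

theorem entropy_weight {α β : Type*} (p : PMF (Symbol X X₀)) (a : BlockStrategy X X₀ S N)
    (f : Symbol X X₀ → α) (g : Option ι → Fin a.seeds → β) :
    entropy (a.weight p) (fun ω => (fun t => f (ω.1 t), fun j => g j (ω.2 j))) =
      N * entropy (sourceWeight p) f + ∑ j, entropy (fun q => (a.seedLaw j q).toReal) (g j) := by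
  have h1 := entropy_pi (κ := Fin N) (fun _ => isLaw_sourceWeight p) fun _ => f
  have h2 := entropy_pi (fun j => isLaw_toReal (a.seedLaw j)) g
  have h := entropy_prod (IsLaw.pi (κ := Fin N) fun _ => isLaw_sourceWeight p)
    (IsLaw.pi fun j => isLaw_toReal (a.seedLaw j)) (fun x t => f (x t)) fun q j => g j (q j)
  rw [h1, h2, Finset.sum_const, Finset.card_univ, Fintype.card_fin, nsmul_eq_mul] at h
  exact h

theorem logKeys_eq_sum (a : BlockStrategy X X₀ S N) :
    a.logKeys = ∑ i, Real.logb 2 (a.keySize i) := by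
  rw [logKeys, Nat.cast_prod, Real.logb_prod]
  exact fun i _ => Nat.cast_ne_zero.2 (a.keySize_pos i).ne'

theorem logKeys_eq_card (a : BlockStrategy X X₀ S N) :
    a.logKeys = Real.logb 2 (Fintype.card (∀ i, Fin (a.keySize i))) := by
  simp [logKeys]

theorem uniformityGap_nonneg (p : PMF (Symbol X X₀)) (a : BlockStrategy X X₀ S N) :
    0 ≤ a.uniformityGap p := by
  rw [uniformityGap, logKeys_eq_card]
  exact sub_nonneg.2 (entropy_le_logb_card (a.isLaw_weight p) _)

theorem leakage_nonneg (p : PMF (Symbol X X₀)) (a : BlockStrategy X X₀ S N) :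
    0 ≤ a.leakage p := mutualInfo_nonneg (a.isLaw_weight p) _ _

theorem errorProb_nonneg (p : PMF (Symbol X X₀)) (a : BlockStrategy X X₀ S N) :
    0 ≤ a.errorProb p := prob_nonneg (a.isLaw_weight p) _

theorem leakage_add_uniformityGap (p : PMF (Symbol X X₀)) (a : BlockStrategy X X₀ S N) :
    a.leakage p + a.uniformityGap p = a.logKeys +
      entropy (a.weight p) (fun ω => (a.publicComm ω.1 ω.2, outsideObs S ω.1)) -
      entropy (a.weight p) fun ω =>
        (a.keys ω.1 ω.2, a.publicComm ω.1 ω.2, outsideObs S ω.1) := by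
  rw [leakage, uniformityGap, mutualInfo]
  ring

theorem nextRound_congr (a : BlockStrategy X X₀ S N) {x y : Fin N → Symbol X X₀}
    {q r : Option ι → Fin a.seeds} {base : Bool} {h : Transcript ι} {i : ι}
    (hx : i ∈ S → agentObs x i = agentObs y i) (hq : q (some i) = r (some i)) :
    a.nextRound base x q h (some i) = a.nextRound base y r h (some i) := by
  simp only [nextRound]
  split_ifs with hi
  · rw [hx hi, hq]
  · rfl

/-- The passivity of the base station enters here: without its messages, the transcript cannot
depend on `baseObs`. -/
theorem run_false_congr (a : BlockStrategy X X₀ S N) {x y : Fin N → Symbol X X₀}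
    (q : Option ι → Fin a.seeds) (hx : ∀ i ∈ S, agentObs x i = agentObs y i)
    (h : Transcript ι) (n : ℕ) : a.run false x q h n = a.run false y q h n := by
  induction n with
  | zero => rfl
  | succ n ih =>
    rw [run, run, ih]
    congr 2
    funext j
    cases j with
    | none => rfl
    | some i => exact a.nextRound_congr (hx i) rfl

/-! ### Converse -/

/-- All that the agents of the coalition know in advance. -/
def agentsView (a : BlockStrategy X X₀ S N)
    (ω : (Fin N → Symbol X X₀) × (Option ι → Fin a.seeds)) :
    (∀ i : S, Fin N → X i) × (ι → Fin a.seeds) :=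
  (fun i => agentObs ω.1 (i : ι), fun i => ω.2 (some i))

/-- All that the base station knows in advance. -/
def baseView (a : BlockStrategy X X₀ S N)
    (ω : (Fin N → Symbol X X₀) × (Option ι → Fin a.seeds)) : (Fin N → X₀) × Fin a.seeds :=
  (baseObs ω.1, ω.2 none)

theorem agentsView_eq_iff (a : BlockStrategy X X₀ S N)
    {ω ω' : (Fin N → Symbol X X₀) × (Option ι → Fin a.seeds)} :
    a.agentsView ω = a.agentsView ω' ↔
      (∀ i ∈ S, agentObs ω.1 i = agentObs ω'.1 i) ∧ ∀ i, ω.2 (some i) = ω'.2 (some i) := by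
  simp [agentsView, funext_iff]

theorem baseView_eq_iff (a : BlockStrategy X X₀ S N)
    {ω ω' : (Fin N → Symbol X X₀) × (Option ι → Fin a.seeds)} :
    a.baseView ω = a.baseView ω' ↔ baseObs ω.1 = baseObs ω'.1 ∧ ω.2 none = ω'.2 none := by
  simp [baseView]

theorem mk_eq_mk_iff_forall {α β κ κ' : Type*} {f f' : κ → α} {g g' : κ' → β} :
    (f, g) = (f', g') ↔ (∀ k, f k = f' k) ∧ ∀ k, g k = g' k := by
  rw [Prod.mk.injEq, funext_iff, funext_iff]

/-- Each of the four entropies splits into `N` single-letter entropies plus seed entropies. The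
seeds of the two sides are independent of each other and of the source, so their entropies cancel.
-/
theorem condMutualInfo_views (p : PMF (Symbol X X₀)) (a : BlockStrategy X X₀ S N) :
    condMutualInfo (a.weight p) a.agentsView a.baseView (fun ω => outsideObs S ω.1) =
      N * sourceInfo p S := by
  have hs : ∀ j, IsLaw fun q => (a.seedLaw j q).toReal := fun j => isLaw_toReal (a.seedLaw j)
  -- The constant `none` masks the seeds that do not belong to the view in question.
  have e1 := entropy_weight p a (fun x => (agentsPart S x, agentsPart Sᶜ x))
    fun j q => if j = none then none else some q
  have e2 := entropy_weight p a (fun x => (x.2, agentsPart Sᶜ x))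
    fun j q => if j = none then some q else none
  have e3 := entropy_weight p a (fun x => (agentsPart S x, x.2, agentsPart Sᶜ x))
    fun j q => some q
  have e4 := entropy_weight p a (agentsPart Sᶜ) fun j q => (none : Option (Fin a.seeds))
  rw [entropy_congr (V := fun ω => (a.agentsView ω, outsideObs S ω.1)) _ (by
    intro ω ω'
    rw [mk_eq_mk_iff_forall]
    simp only [Prod.mk.injEq, agentsPart_eq_iff, agentsView_eq_iff, outsideObs_eq_iff,
      Option.forall, if_true, reduceCtorEq, if_false, Option.some.injEq, true_and, agentObs_eq_iff]
    exact ⟨fun h => ⟨⟨fun i hi t => (h.1 t).1 i hi, h.2⟩, fun i hi t => (h.1 t).2 i hi⟩,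
      fun h => ⟨fun t => ⟨fun i hi => h.1.1 i hi t, fun i hi => h.2 i hi t⟩, h.1.2⟩⟩)] at e1
  rw [entropy_congr (V := fun ω => (a.baseView ω, outsideObs S ω.1)) _ (by
    intro ω ω'
    rw [mk_eq_mk_iff_forall]
    simp only [Prod.mk.injEq, agentsPart_eq_iff, baseView_eq_iff, outsideObs_eq_iff,
      Option.forall, if_true, reduceCtorEq, if_false, Option.some.injEq, agentObs_eq_iff,
      baseObs_eq_iff, implies_true, and_true]
    exact ⟨fun h => ⟨⟨fun t => (h.1 t).1, h.2⟩, fun i hi t => (h.1 t).2 i hi⟩,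
      fun h => ⟨fun t => ⟨h.1.1 t, fun i hi => h.2 i hi t⟩, h.1.2⟩⟩)] at e2
  rw [entropy_congr (V := fun ω => (a.agentsView ω, a.baseView ω, outsideObs S ω.1)) _ (by
    intro ω ω'
    rw [mk_eq_mk_iff_forall]
    simp only [Prod.mk.injEq, agentsPart_eq_iff, baseView_eq_iff, outsideObs_eq_iff,
      Option.forall, Option.some.injEq, agentObs_eq_iff, agentsView_eq_iff, baseObs_eq_iff]
    exact ⟨fun h => ⟨⟨fun i hi t => (h.1 t).1 i hi, h.2.2⟩, ⟨fun t => (h.1 t).2.1, h.2.1⟩,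
        fun i hi t => (h.1 t).2.2 i hi⟩,
      fun h => ⟨fun t => ⟨fun i hi => h.1.1 i hi t, h.2.1.1 t, fun i hi => h.2.2 i hi t⟩,
        h.2.1.2, h.1.2⟩⟩)] at e3
  rw [entropy_congr (V := fun ω => outsideObs S ω.1) _ (by
    intro ω ω'
    rw [mk_eq_mk_iff_forall]
    simp only [agentsPart_eq_iff, outsideObs_eq_iff,
      agentObs_eq_iff, implies_true, and_true]
    exact forall_comm.trans (forall_congr' fun i => forall_comm))] at e4
  have hc : ∀ j, entropy (fun q => (a.seedLaw j q).toReal)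
      (fun _ => (none : Option (Fin a.seeds))) = 0 := fun j => entropy_const (hs j) _
  simp only [Fintype.sum_option, if_true, reduceCtorEq, if_false, hc, Finset.sum_const_zero,
    zero_add, add_zero] at e1 e2 e3 e4
  rw [condMutualInfo, e1, e2, e3, e4, sourceInfo, condMutualInfo]
  ring

/-- Interactive communication does not increase the mutual information of both sides. -/
theorem condMutualInfo_run_le (p : PMF (Symbol X X₀)) (a : BlockStrategy X X₀ S N) (n : ℕ) :
    condMutualInfo (a.weight p) a.agentsView a.baseView
        (fun ω => (a.run true ω.1 ω.2 [] n, outsideObs S ω.1)) ≤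
      condMutualInfo (a.weight p) a.agentsView a.baseView (fun ω => outsideObs S ω.1) := by
  have hw := a.isLaw_weight p
  induction n with
  | zero =>
    refine le_of_eq (condMutualInfo_congr _ _ _ fun ω ω' => ?_)
    simp [run]
  | succ n ih =>
    refine le_trans ?_ ih
    set A := fun ω : (Fin N → Symbol X X₀) × (Option ι → Fin a.seeds) =>
      a.run true ω.1 ω.2 [] n
    set m := fun ω : (Fin N → Symbol X X₀) × (Option ι → Fin a.seeds) =>
      a.nextRound true ω.1 ω.2 (A ω)
    -- Messages of one round depend only on earlier rounds, so the round splits into two one-sided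
    -- disclosures: all agents' messages at once, then the base station's.
    have h1 := condMutualInfo_le_of_determined hw (U := a.agentsView) (V := a.baseView)
      (W := fun ω => (A ω, outsideObs S ω.1)) (f := fun ω i => m ω (some i)) (by
        intro ω ω' hU hW
        rw [agentsView_eq_iff] at hU
        rw [Prod.mk.injEq] at hW
        funext i
        simp only [m, hW.1]
        exact a.nextRound_congr (hU.1 i) (hU.2 i))
    have h2 := condMutualInfo_le_of_determined hw (U := a.baseView) (V := a.agentsView)
      (W := fun ω => ((fun i => m ω (some i)), A ω, outsideObs S ω.1)) (f := fun ω => m ω none) (by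
        intro ω ω' hU hW
        rw [baseView_eq_iff] at hU
        simp only [Prod.mk.injEq] at hW
        simp only [m, hW.2.1, nextRound, hU.1, hU.2])
    rw [condMutualInfo_comm, condMutualInfo_comm (U := a.baseView)] at h2
    refine le_trans (le_of_eq ?_) (h2.trans h1)
    refine condMutualInfo_congr _ _ _ fun ω ω' => ?_
    have hrun : ∀ ω : (Fin N → Symbol X X₀) × (Option ι → Fin a.seeds),
      a.run true ω.1 ω.2 [] (n + 1) = A ω ++ [m ω] := fun _ => rfl
    simp only [hrun, Prod.mk.injEq]
    constructor
    · rintro ⟨h, hZ⟩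
      obtain ⟨hA, hm⟩ := List.append_inj' h rfl
      replace hm := (List.cons_eq_cons.1 hm).1
      exact ⟨congrFun hm none, funext fun i => congrFun hm (some i), hA, hZ⟩
    · rintro ⟨h1, h2, hA, hZ⟩
      have hm : m ω = m ω' := by
        funext j
        cases j with
        | none => exact h1
        | some i => exact congrFun h2 i
      exact ⟨by rw [hA, hm], hZ⟩

/-- Leakage plus uniformity gap is `log |K| - H(K | A, X_{Sᶜ})`, and the secret key converse bounds
that conditional entropy. -/
theorem logKeys_le (p : PMF (Symbol X X₀)) (a : BlockStrategy X X₀ S N) :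
    a.logKeys ≤ N * sourceInfo p S + a.leakage p + a.uniformityGap p +
      (1 + a.errorProb p * a.logKeys) := by
  have h := condEntropy_le_condMutualInfo_add (a.isLaw_weight p) (U := a.agentsView)
    (V := a.baseView) (W := fun ω => (a.publicComm ω.1 ω.2, outsideObs S ω.1))
    (K := fun ω => a.keys ω.1 ω.2) (L := fun ω => a.baseKeys ω.1 ω.2) (by
      intro ω ω' hU hW
      rw [agentsView_eq_iff] at hU
      rw [Prod.mk.injEq] at hW
      funext i
      simp only [keys, hW.1, hU.1 i i.2]) (by
      intro ω ω' hV hW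
      rw [baseView_eq_iff] at hV
      rw [Prod.mk.injEq] at hW
      funext i
      simp only [baseKeys, hW.1, hV.1])
  have h1 := (a.condMutualInfo_run_le p a.rounds).trans_eq (a.condMutualInfo_views p)
  have h2 := a.leakage_add_uniformityGap p
  rw [← logKeys_eq_card] at h
  simp only [publicComm, errorProb] at h h1 h2 ⊢
  linarith

/-! ### What the other agents can do -/

theorem jointLeakage_nonneg (p : PMF (Symbol X X₀)) (a : BlockStrategy X X₀ S N)
    (b : BlockStrategy X X₀ Sᶜ N) : 0 ≤ a.jointLeakage p b :=
  mutualInfo_nonneg (a.isLaw_weight_mul p b) _ _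

/-- Whatever the other agents say, the keys are not leaked more than by their observations. -/
theorem jointLeakage_le_leakage (p : PMF (Symbol X X₀)) (a : BlockStrategy X X₀ S N)
    (b : BlockStrategy X X₀ Sᶜ N) : a.jointLeakage p b ≤ a.leakage p := by
  have hw := a.isLaw_weight_mul p b
  have hb := b.isLaw_seedWeight
  -- Data processing: the joint transcript is a function of `A_S`, the outside observations and the
  -- opponents' seeds, and these seeds are independent of everything else.
  have h1 := entropy_submodular hw (fun ω => a.keys ω.1.1 ω.1.2)
    (fun ω => ((a.publicComm ω.1.1 ω.1.2, outsideObs S ω.1.1), ω.2))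
    fun ω => a.jointComm b ω.1.1 ω.1.2 ω.2
  have hJ : ∀ ω ω' : ((Fin N → Symbol X X₀) × (Option ι → Fin a.seeds)) ×
      (Option ι → Fin b.seeds), a.publicComm ω.1.1 ω.1.2 = a.publicComm ω'.1.1 ω'.1.2 →
      outsideObs S ω.1.1 = outsideObs S ω'.1.1 → ω.2 = ω'.2 →
      a.jointComm b ω.1.1 ω.1.2 ω.2 = a.jointComm b ω'.1.1 ω'.1.2 ω'.2 := by
    intro ω ω' hA hZ hq
    rw [jointComm, jointComm, hA, hq]
    exact b.run_false_congr _ (outsideObs_eq_iff.1 hZ) _ _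
  have h2 := entropy_congr (fun ω : ((Fin N → Symbol X X₀) × (Option ι → Fin a.seeds)) ×
      (Option ι → Fin b.seeds) => a.weight p ω.1 * b.seedWeight ω.2)
    (U := fun ω => (a.keys ω.1.1 ω.1.2,
      ((a.publicComm ω.1.1 ω.1.2, outsideObs S ω.1.1), ω.2), a.jointComm b ω.1.1 ω.1.2 ω.2))
    (V := fun ω => ((a.keys ω.1.1 ω.1.2, a.publicComm ω.1.1 ω.1.2, outsideObs S ω.1.1), ω.2)) (by
      intro ω ω'
      have := hJ ω ω'
      simp only [Prod.mk.injEq]; tauto)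
  have h3 := entropy_congr (fun ω : ((Fin N → Symbol X X₀) × (Option ι → Fin a.seeds)) ×
      (Option ι → Fin b.seeds) => a.weight p ω.1 * b.seedWeight ω.2)
    (U := fun ω => (((a.publicComm ω.1.1 ω.1.2, outsideObs S ω.1.1), ω.2),
      a.jointComm b ω.1.1 ω.1.2 ω.2))
    (V := fun ω => ((a.publicComm ω.1.1 ω.1.2, outsideObs S ω.1.1), ω.2)) (by
      intro ω ω'
      have := hJ ω ω'
      simp only [Prod.mk.injEq]; tauto)
  have e1 := entropy_prod (a.isLaw_weight p) hb (fun ω =>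
    (a.keys ω.1 ω.2, a.publicComm ω.1 ω.2, outsideObs S ω.1)) id
  have e2 := entropy_prod (a.isLaw_weight p) hb (fun ω =>
    (a.publicComm ω.1 ω.2, outsideObs S ω.1)) id
  have e3 := (mapsLaw_fst (a.weight p) hb).entropy_comp fun ω => a.keys ω.1 ω.2
  simp only [id_eq] at e1 e2
  rw [jointLeakage, leakage, mutualInfo, mutualInfo]
  linarith

/-- The agents of `T` say everything they know. -/
def reveal (X : ι → Type*) [∀ i, Fintype (X i)] (X₀ : Type*) (T : Finset ι) (N : ℕ) :
    BlockStrategy X X₀ T N where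
  keySize _ := 1
  keySize_pos _ := one_pos
  seeds := 1
  seedLaw _ := PMF.pure 0
  rounds := 1
  agentMsg i x _ _ := (Fintype.equivFin (Fin N → X i) x : ℕ)
  baseMsg _ _ _ := 0
  key _ _ _ := 0
  baseKey _ _ _ := 0

/-- The joint transcript and the pair of `A_S` and the outside observations determine each other,
because observations are encoded injectively as numbers and `reveal` has a single seed value. -/
theorem jointLeakage_reveal (p : PMF (Symbol X X₀)) (a : BlockStrategy X X₀ S N) :
    a.jointLeakage p (reveal X X₀ Sᶜ N) = a.leakage p := by
  set b := reveal X X₀ Sᶜ N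
  have hb := b.isLaw_seedWeight
  have hJ : ∀ ω ω' : ((Fin N → Symbol X X₀) × (Option ι → Fin a.seeds)) ×
      (Option ι → Fin b.seeds),
      a.jointComm b ω.1.1 ω.1.2 ω.2 = a.jointComm b ω'.1.1 ω'.1.2 ω'.2 ↔
      (a.publicComm ω.1.1 ω.1.2, outsideObs S ω.1.1) =
        (a.publicComm ω'.1.1 ω'.1.2, outsideObs S ω'.1.1) := by
    intro ω ω'
    rw [Prod.mk.injEq, outsideObs_eq_iff]
    constructor
    · intro h
      obtain ⟨hA, hm⟩ := List.append_inj' (show a.publicComm ω.1.1 ω.1.2 ++ [_] =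
        a.publicComm ω'.1.1 ω'.1.2 ++ [_] from h) rfl
      refine ⟨hA, fun i hi => ?_⟩
      have hm' := congrFun (List.cons_eq_cons.1 hm).1 (some i)
      simp only [nextRound, dif_pos hi] at hm'
      exact (Fintype.equivFin (Fin N → X i)).injective (Fin.val_injective hm')
    · rintro ⟨hA, hZ⟩
      rw [jointComm, jointComm, hA, Subsingleton.elim (α := Option ι → Fin 1) ω.2 ω'.2]
      exact b.run_false_congr _ hZ _ _
  have e1 := (mapsLaw_fst (a.weight p) hb).entropy_comp fun ω =>
    (a.keys ω.1 ω.2, a.publicComm ω.1 ω.2, outsideObs S ω.1)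
  have e2 := (mapsLaw_fst (a.weight p) hb).entropy_comp fun ω =>
    (a.publicComm ω.1 ω.2, outsideObs S ω.1)
  have e3 := (mapsLaw_fst (a.weight p) hb).entropy_comp fun ω => a.keys ω.1 ω.2
  rw [jointLeakage, leakage, mutualInfo, mutualInfo, entropy_congr _ hJ, ← e1, ← e2, ← e3]
  congr 1
  refine entropy_congr _ fun ω ω' => ?_
  rw [Prod.mk.injEq, hJ, ← Prod.mk.injEq]

end BlockStrategy

/-- The agents of `T` say everything they know and have trivial keys. -/
def Strategy.reveal (X : ι → Type*) [∀ i, Fintype (X i)] (X₀ : Type*) (T : Finset ι) :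
    Strategy X X₀ T where
  block := BlockStrategy.reveal X X₀ T
  rate _ := 0
  rate_tendsto i := by simp [BlockStrategy.reveal]

theorem sourceInfo_nonneg (p : PMF (Symbol X X₀)) (S : Finset ι) : 0 ≤ sourceInfo p S :=
  condMutualInfo_nonneg (isLaw_sourceWeight p) _ _ _

/-- The sum-rate of secret keys is at most `I(X_S; X_0 | X_{Sᶜ})`. -/
theorem sum_rate_le (p : PMF (Symbol X X₀)) {S : Finset ι} (a : Strategy X X₀ S)
    (he : Tendsto (fun N => (a.block N).errorProb p) atTop (𝓝 0))
    (hl : Tendsto (fun N => (a.block N).leakage p) atTop (𝓝 0))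
    (hu : Tendsto (fun N => (a.block N).uniformityGap p) atTop (𝓝 0)) :
    ∑ i, a.rate i ≤ sourceInfo p S := by
  have h1 : Tendsto (fun N : ℕ => (a.block N).logKeys / N) atTop (𝓝 (∑ i, a.rate i)) := by
    simp only [BlockStrategy.logKeys_eq_sum, Finset.sum_div]
    exact tendsto_finsetSum _ fun i _ => a.rate_tendsto i
  have hN : Tendsto (fun N : ℕ => (N : ℝ)⁻¹) atTop (𝓝 0) := tendsto_inv_atTop_nhds_zero_nat
  have h2 : Tendsto (fun N : ℕ => sourceInfo p S + ((a.block N).leakage p +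
      (a.block N).uniformityGap p + 1) * (N : ℝ)⁻¹ +
      (a.block N).errorProb p * ((a.block N).logKeys / N)) atTop
      (𝓝 (sourceInfo p S + (0 + 0 + 1) * 0 + 0 * ∑ i, a.rate i)) :=
    (tendsto_const_nhds.add (((hl.add hu).add tendsto_const_nhds).mul hN)).add (he.mul h1)
  rw [mul_zero, zero_mul, add_zero, add_zero] at h2
  refine le_of_tendsto_of_tendsto h1 h2 ?_
  filter_upwards [eventually_gt_atTop 0] with N hN0
  have hN0' : (0 : ℝ) < N := Nat.cast_pos.2 hN0
  have h := (a.block N).logKeys_le p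
  rw [div_le_iff₀ hN0']
  field_simp
  linarith

end Laws

/-! ### Random hashing -/

section Hashing

set_option linter.unusedSectionVars false

variable {Ω α β γ : Type*} [Fintype Ω] [Fintype α]

/-- The conditional probability of the value of `U`, given the value of `V`. -/
def condProb (w : Ω → ℝ) (U : Ω → α) (V : Ω → β) (ω : Ω) : ℝ :=
  prob w (fun ω' => U ω' = U ω ∧ V ω' = V ω) / prob w fun ω' => V ω' = V ω

theorem condProb_pos {w : Ω → ℝ} (hw : IsLaw w) (U : Ω → α) (V : Ω → β) {ω : Ω} (h : 0 < w ω) :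
    0 < condProb w U V ω :=
  div_pos (prob_pos hw (E := fun ω' => U ω' = U ω ∧ V ω' = V ω) ⟨rfl, rfl⟩ h) (prob_eq_pos hw V h)

theorem condProb_nonneg {w : Ω → ℝ} (hw : IsLaw w) (U : Ω → α) (V : Ω → β) (ω : Ω) :
    0 ≤ condProb w U V ω := div_nonneg (prob_nonneg hw _) (prob_nonneg hw _)

theorem condEntropy_eq_sum {w : Ω → ℝ} (hw : IsLaw w) (U : Ω → α) (V : Ω → β) :
    Real.log 2 * (entropy w (fun ω => (U ω, V ω)) - entropy w V) =
      -∑ ω, w ω * Real.log (condProb w U V ω) := by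
  have h2 : Real.log 2 ≠ 0 := (Real.log_pos one_lt_two).ne'
  rw [entropy_eq_sum, entropy_eq_sum, neg_sub_neg, ← Finset.sum_sub_distrib, Finset.mul_sum,
    ← Finset.sum_neg_distrib]
  refine Finset.sum_congr rfl fun ω _ => ?_
  rcases (hw.nonneg ω).eq_or_lt with h0 | h0
  · simp [← h0]
  · have h1 : 0 < prob w fun ω' => U ω' = U ω ∧ V ω' = V ω :=
      prob_pos hw (E := fun ω' => U ω' = U ω ∧ V ω' = V ω) ⟨rfl, rfl⟩ h0
    rw [condProb, Real.log_div h1.ne' (prob_eq_pos hw V h0).ne', Real.logb, Real.logb]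
    simp only [Prod.mk.injEq]
    field_simp
    ring

/-- Pairwise independence of a uniformly random function: with all values of `F` off `u'` fixed, `F
u'` still runs uniformly through `B`. -/
theorem sum_apply_apply {B : Type*} [DecidableEq α] [Fintype B] {u u' : α} (h : u ≠ u')
    (φ : B → B → ℝ) {m : ℝ} (hφ : ∀ c, ∑ b, φ c b = m) :
    Fintype.card B * ∑ F : α → B, φ (F u) (F u') = Fintype.card (α → B) * m := by
  have h1 : ∑ F : α → B, φ (F u) (F u') = ∑ x : B × ({j // j ≠ u'} → B), φ (x.2 ⟨u, h⟩) x.1 :=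
    Fintype.sum_equiv (Equiv.funSplitAt u' B) _ _ fun F => rfl
  rw [h1, Fintype.sum_prod_type_right, Fintype.card_congr (Equiv.funSplitAt u' B),
    Fintype.card_prod]
  simp only [hφ, Finset.sum_const, Finset.card_univ, nsmul_eq_mul]
  push_cast
  ring

/-- Subadditivity of `x ↦ x ^ s`. A power, unlike the logarithm, factorises over independent copies.
-/
theorem log_one_add_le_rpow_div {x s : ℝ} (hx : 0 ≤ x) (hs : 0 < s) (hs1 : s ≤ 1) :
    Real.log (1 + x) ≤ x ^ s / s := by
  have h1 : (1 + x) ^ s ≤ 1 + x ^ s := by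
    simpa using Real.rpow_add_le_add_rpow zero_le_one hx hs.le hs1
  rw [le_div_iff₀ hs, mul_comm, ← Real.log_rpow (by positivity)]
  calc _ ≤ Real.log (1 + x ^ s) := Real.log_le_log (by positivity) h1
    _ ≤ 1 + x ^ s - 1 := Real.log_le_sub_one_of_pos (by positivity)
    _ = x ^ s := by ring

open Classical in
/-- Privacy amplification: a random hash of `U` is nearly uniform given `Z`. -/
theorem sum_hash_condEntropy_le {B : Type*} [Fintype B] [Nonempty B] {w : Ω → ℝ} (hw : IsLaw w)
    (U : Ω → α) (Z : Ω → γ) {s : ℝ} (hs : 0 < s) (hs1 : s ≤ 1) :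
    ∑ F : α → B, (Real.log (Fintype.card B) - Real.log 2 *
        (entropy w (fun ω => (F (U ω), Z ω)) - entropy w Z)) ≤
      Fintype.card (α → B) * ((∑ ω, w ω * (Fintype.card B * condProb w U Z ω) ^ s) / s) := by
  set M : ℝ := ((Fintype.card B : ℕ) : ℝ) with hMdef
  set T : ℝ := ((Fintype.card (α → B) : ℕ) : ℝ) with hTdef
  have hM : 0 < M := by rw [hMdef]; exact_mod_cast Fintype.card_pos
  have hT : 0 < T := by rw [hTdef]; exact_mod_cast Fintype.card_pos
  have hF : ∀ F : α → B, Real.log M - Real.log 2 *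
      (entropy w (fun ω => (F (U ω), Z ω)) - entropy w Z) =
      ∑ ω, w ω * Real.log (M * condProb w (fun ω => F (U ω)) Z ω) := by
    intro F
    rw [condEntropy_eq_sum hw, sub_neg_eq_add]
    conv_lhs => rw [← one_mul (Real.log M), ← hw.sum_eq_one, Finset.sum_mul]
    rw [← Finset.sum_add_distrib]
    refine Finset.sum_congr rfl fun ω _ => ?_
    rcases (hw.nonneg ω).eq_or_lt with h0 | h0
    · simp [← h0]
    · rw [Real.log_mul hM.ne' (condProb_pos hw _ Z h0).ne']
      ring
  simp only [hF]
  rw [Finset.sum_comm, Finset.sum_div, Finset.mul_sum]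
  refine Finset.sum_le_sum fun ω _ => ?_
  rcases (hw.nonneg ω).eq_or_lt with h0 | h0
  · simp [← h0]
  rw [← Finset.mul_sum, mul_div_assoc, mul_left_comm]
  refine mul_le_mul_of_nonneg_left ?_ h0.le
  set c := condProb w U Z ω
  have hc : 0 < c := condProb_pos hw U Z h0
  set Q := prob w fun ω' => Z ω' = Z ω
  have hQ : 0 < Q := prob_eq_pos hw Z h0
  have hm : 0 < 1 + M * c := by positivity
  -- Distinct values collide for a fraction `1 / M` of the hashes, equal values for all of them.
  have hpair : ∀ ω', M * ∑ F : α → B, (if F (U ω') = F (U ω) then (1 : ℝ) else 0) ≤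
      T * (1 + if U ω' = U ω then M else 0) := by
    intro ω'
    by_cases h : U ω' = U ω
    · simp only [h, if_true, Finset.sum_const, Finset.card_univ, nsmul_eq_mul]
      rw [← hTdef]
      nlinarith
    · rw [if_neg h, add_zero]
      exact (sum_apply_apply h (fun c b : B => if c = b then (1 : ℝ) else 0) (m := 1)
        (by simp)).le
  have hsum : ∑ F : α → B, M * condProb w (fun ω => F (U ω)) Z ω ≤ T * (1 + M * c) := by
    have e1 : ∀ F : α → B, M * condProb w (fun ω => F (U ω)) Z ω =
        (∑ ω', (if Z ω' = Z ω then w ω' else 0) *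
          (M * if F (U ω') = F (U ω) then (1 : ℝ) else 0)) / Q := by
      intro F
      rw [condProb, prob_eq_sum_ite, mul_div_assoc', Finset.mul_sum]
      congr 1
      refine Finset.sum_congr rfl fun ω' _ => ?_
      by_cases h1 : Z ω' = Z ω <;> by_cases h2 : F (U ω') = F (U ω) <;> simp [h1, h2, mul_comm]
    simp only [e1]
    rw [← Finset.sum_div, Finset.sum_comm, div_le_iff₀ hQ]
    calc _ = ∑ ω', (if Z ω' = Z ω then w ω' else 0) *
          (M * ∑ F : α → B, if F (U ω') = F (U ω) then (1 : ℝ) else 0) := by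
          refine Finset.sum_congr rfl fun ω' _ => ?_
          rw [← Finset.mul_sum, ← Finset.mul_sum]
      _ ≤ ∑ ω', (if Z ω' = Z ω then w ω' else 0) * (T * (1 + if U ω' = U ω then M else 0)) := by
          refine Finset.sum_le_sum fun ω' _ => mul_le_mul_of_nonneg_left (hpair ω') ?_
          split_ifs
          exacts [hw.nonneg ω', le_rfl]
      _ = T * (Q + M * prob w fun ω' => U ω' = U ω ∧ Z ω' = Z ω) := by
          simp only [Q, prob_eq_sum_ite, Finset.mul_sum, ← Finset.sum_add_distrib]
          refine Finset.sum_congr rfl fun ω' _ => ?_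
          by_cases h1 : Z ω' = Z ω <;> by_cases h2 : U ω' = U ω <;> simp [h1, h2]
          all_goals ring
      _ = T * (1 + M * c) * Q := by
          rw [show c = (prob w fun ω' => U ω' = U ω ∧ Z ω' = Z ω) / Q from rfl]
          field_simp
  -- Jensen's inequality for the average over `F`, through the tangent of the logarithm at `1 + M *
  -- c`.
  calc ∑ F : α → B, Real.log (M * condProb w (fun ω => F (U ω)) Z ω)
      ≤ ∑ F : α → B, (M * condProb w (fun ω => F (U ω)) Z ω / (1 + M * c) - 1 +
          Real.log (1 + M * c)) := by
        refine Finset.sum_le_sum fun F _ => ?_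
        have hp : 0 < M * condProb w (fun ω => F (U ω)) Z ω :=
          mul_pos hM (condProb_pos hw (fun ω => F (U ω)) Z h0)
        have := Real.log_le_sub_one_of_pos (div_pos hp hm)
        rw [Real.log_div hp.ne' hm.ne'] at this
        linarith
    _ = (∑ F : α → B, M * condProb w (fun ω => F (U ω)) Z ω) / (1 + M * c) - T +
          T * Real.log (1 + M * c) := by
        rw [Finset.sum_add_distrib, Finset.sum_sub_distrib, Finset.sum_div]
        simp [hTdef]
    _ ≤ T * Real.log (1 + M * c) := by
        have := (div_le_iff₀ hm).2 hsum
        linarith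
    _ ≤ T * ((M * c) ^ s / s) :=
        mul_le_mul_of_nonneg_left (log_one_add_le_rpow_div (by positivity) hs hs1) hT.le

/-- Decoding `U` from `V` and the first component of its hash `F U`: the most probable value. -/
def decode {Mb Mk : ℕ} [Nonempty α] (w : Ω → ℝ) (U : Ω → α) (V : Ω → β)
    (F : α → Fin Mb × Fin Mk) (v : β) (m : ℕ) : α :=
  Classical.epsilon fun u => ((F u).1 : ℕ) = m ∧ ∀ u', ((F u').1 : ℕ) = m →
    prob w (fun ω => U ω = u' ∧ V ω = v) ≤ prob w fun ω => U ω = u ∧ V ω = v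

/-- A maximiser exists in the finite bin, so the chosen value really is one, and it serves as the
competitor. A tie may count as an error. -/
theorem decode_ne {Mb Mk : ℕ} [Nonempty α] (w : Ω → ℝ) (U : Ω → α) (V : Ω → β)
    (F : α → Fin Mb × Fin Mk) {v : β} {u : α} (h : decode w U V F v (F u).1 ≠ u) :
    ∃ u', u ≠ u' ∧ (F u).1 = (F u').1 ∧
      prob w (fun ω => U ω = u ∧ V ω = v) ≤ prob w fun ω => U ω = u' ∧ V ω = v := by
  classical
  obtain ⟨u₁, hu₁, hmax⟩ := Finset.exists_max_image
    (Finset.univ.filter fun u' => ((F u').1 : ℕ) = (F u).1)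
    (fun u => prob w fun ω => U ω = u ∧ V ω = v) ⟨u, by simp⟩
  simp only [Finset.mem_filter, Finset.mem_univ, true_and] at hu₁ hmax
  have hd := Classical.epsilon_spec (p := fun u₀ => ((F u₀).1 : ℕ) = (F u).1 ∧ ∀ u',
    ((F u').1 : ℕ) = (F u).1 → prob w (fun ω => U ω = u' ∧ V ω = v) ≤
      prob w fun ω => U ω = u₀ ∧ V ω = v) ⟨u₁, hu₁, hmax⟩
  exact ⟨_, h.symm, (Fin.val_injective hd.1).symm, hd.2 u rfl⟩

open Classical in
/-- Slepian-Wolf coding: `U` can be recovered from `V` and a random hash. -/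
theorem sum_hash_decode_ne_le {Mb Mk : ℕ} [NeZero Mb] [NeZero Mk] [Nonempty α] {w : Ω → ℝ}
    (hw : IsLaw w) (U : Ω → α) (V : Ω → β) {s : ℝ} (hs : 0 < s) (hs1 : s ≤ 1) :
    ∑ F : α → Fin Mb × Fin Mk, prob w (fun ω => decode w U V F (V ω) (F (U ω)).1 ≠ U ω) ≤
      Fintype.card (α → Fin Mb × Fin Mk) * ∑ ω, w ω * (Mb * condProb w U V ω) ^ (-s) := by
  set T : ℝ := ((Fintype.card (α → Fin Mb × Fin Mk) : ℕ) : ℝ) with hTdef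
  have hT : 0 < T := by rw [hTdef]; exact_mod_cast Fintype.card_pos
  have hMb : (0 : ℝ) < Mb := by exact_mod_cast NeZero.pos Mb
  have hMk : (0 : ℝ) < Mk := by exact_mod_cast NeZero.pos Mk
  have e : ∀ F : α → Fin Mb × Fin Mk, prob w (fun ω => decode w U V F (V ω) (F (U ω)).1 ≠ U ω) =
      ∑ ω, w ω * if decode w U V F (V ω) (F (U ω)).1 ≠ U ω then 1 else 0 := by
    intro F
    rw [prob_eq_sum_ite]
    simp only [mul_ite, mul_one, mul_zero]
    congr!
  simp only [e]
  rw [Finset.sum_comm, Finset.mul_sum]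
  refine Finset.sum_le_sum fun ω _ => ?_
  rcases (hw.nonneg ω).eq_or_lt with h0 | h0
  · simp [← h0]
  rw [← Finset.mul_sum, mul_left_comm]
  refine mul_le_mul_of_nonneg_left ?_ h0.le
  set c := condProb w U V ω
  have hc : 0 < c := condProb_pos hw U V h0
  set Q := prob w fun ω' => V ω' = V ω
  have hQ : 0 < Q := prob_eq_pos hw V h0
  set P := fun u => prob w fun ω' => U ω' = u ∧ V ω' = V ω
  have hP : 0 < P (U ω) :=
    prob_pos hw (E := fun ω' => U ω' = U ω ∧ V ω' = V ω) ⟨rfl, rfl⟩ h0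
  set D := Finset.univ.filter fun u' => U ω ≠ u' ∧ P (U ω) ≤ P u'
  have hcoll : ∀ u' ∈ D, ∑ F : α → Fin Mb × Fin Mk,
      (if (F (U ω)).1 = (F u').1 then (1 : ℝ) else 0) = T / Mb := by
    intro u' hu'
    have h := sum_apply_apply (Finset.mem_filter.1 hu').2.1
      (fun c b : Fin Mb × Fin Mk => if c.1 = b.1 then (1 : ℝ) else 0) (m := Mk) (by
        intro c
        rw [Fintype.sum_prod_type_right]
        have hy : ∀ y : Fin Mk, ∑ x : Fin Mb, (if c.1 = (x, y).1 then (1 : ℝ) else 0) = 1 := by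
          intro y
          rw [Finset.sum_eq_single c.1 (fun x _ hx => if_neg hx.symm) (by simp)]
          exact if_pos rfl
        simp [hy])
    rw [Fintype.card_prod, Fintype.card_fin, Fintype.card_fin, ← hTdef] at h
    push_cast at h
    rw [eq_div_iff hMb.ne']
    have := mul_right_cancel₀ hMk.ne' (a := Mb * ∑ F : α → Fin Mb × Fin Mk,
      (if (F (U ω)).1 = (F u').1 then (1 : ℝ) else 0)) (b := Mk) (c := T) (by rw [← h]; ring)
    rw [← this]; ring
  -- Given `V`, each competitor is at least as probable as the true value, whose conditional
  -- probability is `c`; these probabilities sum to at most 1.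
  have hD : (D.card : ℝ) ≤ c⁻¹ := by
    have h1 : (D.card : ℝ) * P (U ω) ≤ Q := by
      calc (D.card : ℝ) * P (U ω) = ∑ u' ∈ D, P (U ω) := by simp
        _ ≤ ∑ u' ∈ D, P u' := Finset.sum_le_sum fun u' hu' => (Finset.mem_filter.1 hu').2.2
        _ ≤ ∑ u', P u' :=
            Finset.sum_le_sum_of_subset_of_nonneg (Finset.subset_univ _)
              fun _ _ _ => prob_nonneg hw _
        _ = Q := by
            rw [show Q = _ from (sum_prob_and w U fun ω' => V ω' = V ω).symm]
            refine (Finset.sum_subset (Finset.subset_univ _) fun u _ hu => ?_).symm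
            simp only [P, prob_eq_sum_ite]
            refine Finset.sum_eq_zero fun ω' _ => if_neg ?_
            rintro ⟨rfl, -⟩
            exact hu (Finset.mem_image_of_mem U (Finset.mem_univ ω'))
    rw [show c⁻¹ = Q / P (U ω) from inv_div _ _, le_div_iff₀ hP]
    exact h1
  have hle1 : ∑ F : α → Fin Mb × Fin Mk,
      (if decode w U V F (V ω) (F (U ω)).1 ≠ U ω then (1 : ℝ) else 0) ≤ T := by
    calc _ ≤ ∑ F : α → Fin Mb × Fin Mk, (1 : ℝ) :=
          Finset.sum_le_sum fun F _ => by split_ifs <;> norm_num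
      _ = T := by simp [hTdef]
  have hle2 : ∑ F : α → Fin Mb × Fin Mk,
      (if decode w U V F (V ω) (F (U ω)).1 ≠ U ω then (1 : ℝ) else 0) ≤ T * (Mb * c)⁻¹ := by
    calc _ ≤ ∑ F : α → Fin Mb × Fin Mk, ∑ u' ∈ D,
            (if (F (U ω)).1 = (F u').1 then (1 : ℝ) else 0) := by
          refine Finset.sum_le_sum fun F _ => ?_
          have hn : ∀ u' ∈ D, (0 : ℝ) ≤ if (F (U ω)).1 = (F u').1 then 1 else 0 := fun u' _ => by
            split_ifs <;> norm_num
          split_ifs with h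
          · obtain ⟨u', h1, h2, h3⟩ := decode_ne w U V F h
            have hu' : u' ∈ D := Finset.mem_filter.2 ⟨Finset.mem_univ _, h1, h3⟩
            simpa [h2] using Finset.single_le_sum hn hu'
          · exact Finset.sum_nonneg hn
      _ = D.card * (T / Mb) := by
          rw [Finset.sum_comm, Finset.sum_congr rfl hcoll, Finset.sum_const, nsmul_eq_mul]
      _ ≤ c⁻¹ * (T / Mb) := mul_le_mul_of_nonneg_right hD (by positivity)
      _ = T * (Mb * c)⁻¹ := by
          field_simp
  -- The smaller of 1 and `(Mb * c)⁻¹` is at most `(Mb * c) ^ (-s)` for `0 < s ≤ 1`.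
  rcases le_total (Mb * c) 1 with h | h
  · refine hle1.trans (le_mul_of_one_le_right hT.le ?_)
    exact Real.one_le_rpow_of_pos_of_le_one_of_nonpos (by positivity) h (by linarith)
  · refine hle2.trans (mul_le_mul_of_nonneg_left ?_ hT.le)
    rw [← Real.rpow_neg_one]
    exact Real.rpow_le_rpow_of_exponent_le h (by linarith)

/-- There is a hash function whose first component allows for decoding with the side information
`V`, and which is nearly uniform given `Z`. -/
theorem exists_hash {Mb Mk : ℕ} [NeZero Mb] [NeZero Mk] [Nonempty α] {w : Ω → ℝ} (hw : IsLaw w)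
    (U : Ω → α) (V : Ω → β) (Z : Ω → γ) {s : ℝ} (hs : 0 < s) (hs1 : s ≤ 1) :
    ∃ F : α → Fin Mb × Fin Mk,
      prob w (fun ω => decode w U V F (V ω) (F (U ω)).1 ≠ U ω) + (Real.log (Mb * Mk) -
        Real.log 2 * (entropy w (fun ω => (F (U ω), Z ω)) - entropy w Z)) ≤
      ∑ ω, w ω * (Mb * condProb w U V ω) ^ (-s) +
        (∑ ω, w ω * (Mb * Mk * condProb w U Z ω) ^ s) / s := by
  classical
  have h1 := sum_hash_decode_ne_le (Mb := Mb) (Mk := Mk) hw U V hs hs1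
  have h2 := sum_hash_condEntropy_le (B := Fin Mb × Fin Mk) hw U Z hs hs1
  simp only [Fintype.card_prod, Fintype.card_fin, Nat.cast_mul] at h2
  -- Averaging the sum of both quantities yields a single hash that is good for decoding and for
  -- secrecy.
  have h := add_le_add h1 h2
  rw [← Finset.sum_add_distrib, ← mul_add] at h
  obtain ⟨F, -, hF⟩ := Finset.exists_le_of_sum_le (s := Finset.univ)
    (f := fun F : α → Fin Mb × Fin Mk =>
      prob w (fun ω => decode w U V F (V ω) (F (U ω)).1 ≠ U ω) + (Real.log (Mb * Mk) -
        Real.log 2 * (entropy w (fun ω => (F (U ω), Z ω)) - entropy w Z)))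
    (g := fun _ : α → Fin Mb × Fin Mk => ∑ ω, w ω * (Mb * condProb w U V ω) ^ (-s) +
        (∑ ω, w ω * (Mb * Mk * condProb w U Z ω) ^ s) / s) Finset.univ_nonempty (by
      rw [Finset.sum_const, Finset.card_univ, nsmul_eq_mul]
      exact h)
  exact ⟨F, hF⟩

end Hashing

/-! ### Hashing many independent copies -/

section Blocks

set_option linter.unusedSectionVars false

variable {A α β γ : Type*} [Fintype A] [Fintype α]

/-- The law of `N` independent copies. -/
def powWeight (w : A → ℝ) (N : ℕ) (x : Fin N → A) : ℝ := ∏ t, w (x t)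

theorem IsLaw.pow {w : A → ℝ} (hw : IsLaw w) (N : ℕ) : IsLaw (powWeight w N) :=
  IsLaw.pi fun _ => hw

theorem condProb_powWeight (w : A → ℝ) (U : A → α) (V : A → β) {N : ℕ} (x : Fin N → A) :
    condProb (powWeight w N) (fun x t => U (x t)) (fun x t => V (x t)) x =
      ∏ t, condProb w U V (x t) := by
  have h1 := prob_pi (κ := Fin N) (fun _ => w) fun t a => U a = U (x t) ∧ V a = V (x t)
  have h2 := prob_pi (κ := Fin N) (fun _ => w) fun t a => V a = V (x t)
  simp only [condProb, Finset.prod_div_distrib]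
  rw [← h1, ← h2]
  congr 1 <;> refine prob_congr _ fun y => ?_
  · rw [funext_iff, funext_iff, forall_and]
  · rw [funext_iff]

theorem sum_powWeight_mul_rpow {w : A → ℝ} (hw : IsLaw w) (U : A → α) (V : A → β) (N : ℕ) {M : ℝ}
    (hM : 0 ≤ M) (e : ℝ) :
    ∑ x, powWeight w N x *
        (M * condProb (powWeight w N) (fun x t => U (x t)) (fun x t => V (x t)) x) ^ e =
      M ^ e * (∑ a, w a * condProb w U V a ^ e) ^ N := by
  have h := sum_pi_prod (κ := Fin N) fun _ a => w a * condProb w U V a ^ e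
  rw [Finset.prod_const, Finset.card_univ, Fintype.card_fin] at h
  rw [← h, Finset.mul_sum]
  refine Finset.sum_congr rfl fun x _ => ?_
  rw [condProb_powWeight, Real.mul_rpow hM (Finset.prod_nonneg fun t _ => condProb_nonneg hw U V _),
    ← Real.finsetProd_rpow _ _ fun t _ => condProb_nonneg hw U V _, powWeight,
    Finset.prod_mul_distrib]
  ring

/-- Second-order bound on the moment generating function of `log c`, from `exp y ≤ 1 + y + y ^ 2`
for `|y| ≤ 1`. The linear term becomes an entropy; `C` does not depend on `e`. -/
theorem exists_sum_rpow_le {w : A → ℝ} (hw : IsLaw w) {c : A → ℝ} (hc : ∀ a, 0 < w a → 0 < c a) :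
    ∃ C > 0, ∀ e : ℝ, |e| * C ≤ 1 →
      ∑ a, w a * c a ^ e ≤ Real.exp (e * ∑ a, w a * Real.log (c a) + e ^ 2 * C) := by
  set C₁ := ∑ a, |Real.log (c a)|
  set C₂ := ∑ a, w a * Real.log (c a) ^ 2
  have hC₁ : 0 ≤ C₁ := Finset.sum_nonneg fun _ _ => abs_nonneg _
  have hC₂ : 0 ≤ C₂ := Finset.sum_nonneg fun a _ => mul_nonneg (hw.nonneg a) (sq_nonneg _)
  refine ⟨C₁ + C₂ + 1, by positivity, fun e he => ?_⟩
  have hterm : ∀ a, w a * c a ^ e ≤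
      w a + e * (w a * Real.log (c a)) + e ^ 2 * (w a * Real.log (c a) ^ 2) := by
    intro a
    rcases (hw.nonneg a).eq_or_lt with h0 | h0
    · simp [← h0]
    have h1 : |Real.log (c a) * e| ≤ 1 := by
      rw [abs_mul, mul_comm]
      refine le_trans (mul_le_mul_of_nonneg_left ?_ (abs_nonneg e)) he
      have : |Real.log (c a)| ≤ C₁ :=
        Finset.single_le_sum (f := fun a => |Real.log (c a)|) (fun _ _ => abs_nonneg _)
          (Finset.mem_univ a)
      linarith
    have h2 := (abs_le.1 (Real.abs_exp_sub_one_sub_id_le h1)).2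
    rw [Real.rpow_def_of_pos (hc a h0)]
    nlinarith
  calc _ ≤ _ := Finset.sum_le_sum fun a _ => hterm a
    _ = 1 + (e * ∑ a, w a * Real.log (c a) + e ^ 2 * C₂) := by
        rw [Finset.sum_add_distrib, Finset.sum_add_distrib, hw.sum_eq_one, ← Finset.mul_sum,
          ← Finset.mul_sum, add_assoc]
    _ ≤ Real.exp (e * ∑ a, w a * Real.log (c a) + e ^ 2 * C₂) := by
        rw [add_comm]
        exact Real.add_one_le_exp _
    _ ≤ _ := by
        refine Real.exp_le_exp.2 ?_
        nlinarith [sq_nonneg e]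

/-- For small `s` the quadratic errors `s ^ 2 * C` and `s ^ 2 * C'` are at most `s * δ`, so one
exponent serves both decoding and secrecy. -/
theorem exists_exponent {w : A → ℝ} (hw : IsLaw w) (U : A → α) (V : A → β) (Z : A → γ) {δ : ℝ}
    (hδ : 0 < δ) :
    ∃ s : ℝ, 0 < s ∧ s ≤ 1 ∧
      ∑ a, w a * condProb w U V a ^ (-s) ≤
        Real.exp (s * (Real.log 2 * (entropy w (fun a => (U a, V a)) - entropy w V) + δ)) ∧
      ∑ a, w a * condProb w U Z a ^ s ≤
        Real.exp (-s * (Real.log 2 * (entropy w (fun a => (U a, Z a)) - entropy w Z) - δ)) := by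
  obtain ⟨C, hC, h⟩ := exists_sum_rpow_le hw fun a => condProb_pos hw U V
  obtain ⟨C', hC', h'⟩ := exists_sum_rpow_le hw fun a => condProb_pos hw U Z
  set D := C + C' + 1
  have hD : 0 < D := by positivity
  set s := min 1 δ / D
  have hm : 0 < min 1 δ := lt_min one_pos hδ
  have hs : 0 < s := div_pos hm hD
  have hsD : s * D = min 1 δ := div_mul_cancel₀ _ hD.ne'
  have h1 : s * D ≤ 1 := hsD ▸ min_le_left _ _
  have h2 : s * D ≤ δ := hsD ▸ min_le_right _ _
  have hDC : C ≤ D := by simp only [D]; linarith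
  have hDC' : C' ≤ D := by simp only [D]; linarith
  have hD1 : 1 ≤ D := by simp only [D]; linarith
  refine ⟨s, hs, by nlinarith, (h (-s) ?_).trans (Real.exp_le_exp.2 ?_),
    (h' s ?_).trans (Real.exp_le_exp.2 ?_)⟩
  · rw [abs_neg, abs_of_pos hs]
    nlinarith
  · rw [condEntropy_eq_sum hw]
    nlinarith [mul_le_mul_of_nonneg_left hDC hs.le]
  · rw [abs_of_pos hs]
    nlinarith
  · rw [condEntropy_eq_sum hw]
    nlinarith [mul_le_mul_of_nonneg_left hDC' hs.le]

/-- Of the rate margin `2 * δ`, one `δ` pays for the second-order term; the other makes both bounds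
decay like `exp (-s * δ * N)`, uniformly in `Mb` and `Mk`. -/
theorem eventually_exists_hash {w : A → ℝ} (hw : IsLaw w) (U : A → α) (V : A → β) (Z : A → γ)
    {δ ε : ℝ} (hδ : 0 < δ) (hε : 0 < ε) :
    ∀ᶠ N : ℕ in atTop, ∀ Mb Mk : ℕ, 0 < Mb → 0 < Mk →
      Real.exp (N * (Real.log 2 * (entropy w (fun a => (U a, V a)) - entropy w V) + 2 * δ)) ≤ Mb →
      Mb * Mk ≤
        Real.exp (N * (Real.log 2 * (entropy w (fun a => (U a, Z a)) - entropy w Z) - 2 * δ)) →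
      ∃ (F : (Fin N → α) → Fin Mb × Fin Mk) (κ : (Fin N → β) → ℕ → Fin Mk),
        prob (powWeight w N) (fun x => κ (fun t => V (x t)) (F fun t => U (x t)).1 ≠
          (F fun t => U (x t)).2) < ε ∧
        Real.logb 2 (Mb * Mk) - (entropy (powWeight w N)
          (fun x => (F fun t => U (x t), fun t => Z (x t))) -
          entropy (powWeight w N) fun x t => Z (x t)) < ε := by
  obtain ⟨a₀⟩ := hw.nonempty
  obtain ⟨s, hs, hs1, h1, h2⟩ := exists_exponent hw U V Z hδ
  set hV := Real.log 2 * (entropy w (fun a => (U a, V a)) - entropy w V)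
  set hZ := Real.log 2 * (entropy w (fun a => (U a, Z a)) - entropy w Z)
  have hl2 : 0 < Real.log 2 := Real.log_pos one_lt_two
  have hlim : Tendsto (fun N : ℕ => (1 + 1 / s) * Real.exp (-(s * δ) * N)) atTop (𝓝 0) := by
    rw [← mul_zero (1 + 1 / s)]
    refine tendsto_const_nhds.mul (Real.tendsto_exp_atBot.comp ?_)
    exact tendsto_natCast_atTop_atTop.const_mul_atTop_of_neg (by nlinarith)
  filter_upwards [hlim.eventually_lt_const (lt_min hε (mul_pos hε hl2))] with N hN
  intro Mb Mk hMb hMk hb hbk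
  have : NeZero Mb := ⟨hMb.ne'⟩
  have : NeZero Mk := ⟨hMk.ne'⟩
  have : Nonempty (Fin N → α) := ⟨fun _ => U a₀⟩
  have hMb' : (0 : ℝ) < Mb := Nat.cast_pos.2 hMb
  have hMk' : (0 : ℝ) < Mk := Nat.cast_pos.2 hMk
  have hw' := hw.pow N
  obtain ⟨F, hF⟩ := exists_hash (Mb := Mb) (Mk := Mk) hw' (fun x t => U (x t))
    (fun x t => V (x t)) (fun x t => Z (x t)) hs hs1
  rw [sum_powWeight_mul_rpow hw U V N hMb'.le,
    sum_powWeight_mul_rpow hw U Z N (mul_pos hMb' hMk').le] at hF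
  have hn : ∀ (f : A → ℝ) (e : ℝ), (∀ a, 0 ≤ f a) → 0 ≤ ∑ a, w a * f a ^ e := fun f e hf =>
    Finset.sum_nonneg fun a _ => mul_nonneg (hw.nonneg a) (Real.rpow_nonneg (hf a) _)
  have b1 : (Mb : ℝ) ^ (-s) * (∑ a, w a * condProb w U V a ^ (-s)) ^ N ≤
      Real.exp (-(s * δ) * N) := by
    calc _ ≤ Real.exp (N * (hV + 2 * δ)) ^ (-s) * Real.exp (s * (hV + δ)) ^ N :=
          mul_le_mul (Real.rpow_le_rpow_of_nonpos (Real.exp_pos _) hb (by linarith))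
            (pow_le_pow_left₀ (hn _ _ (condProb_nonneg hw U V)) h1 N)
            (pow_nonneg (hn _ _ (condProb_nonneg hw U V)) N) (by positivity)
      _ = Real.exp (-(s * δ) * N) := by
          rw [← Real.exp_mul, ← Real.exp_nat_mul, ← Real.exp_add]
          ring_nf
  have b2 : ((Mb : ℝ) * Mk) ^ s * (∑ a, w a * condProb w U Z a ^ s) ^ N ≤
      Real.exp (-(s * δ) * N) := by
    calc _ ≤ Real.exp (N * (hZ - 2 * δ)) ^ s * Real.exp (-s * (hZ - δ)) ^ N :=
          mul_le_mul (Real.rpow_le_rpow (by positivity) hbk hs.le)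
            (pow_le_pow_left₀ (hn _ _ (condProb_nonneg hw U Z)) h2 N)
            (pow_nonneg (hn _ _ (condProb_nonneg hw U Z)) N) (by positivity)
      _ = Real.exp (-(s * δ) * N) := by
          rw [← Real.exp_mul, ← Real.exp_nat_mul, ← Real.exp_add]
          ring_nf
  have hF' : _ < min ε (ε * Real.log 2) := (hF.trans (add_le_add b1
    (div_le_div_of_nonneg_right b2 hs.le))).trans_lt (lt_of_eq_of_lt (by ring) hN)
  obtain ⟨hF1, hF2⟩ := lt_min_iff.1 hF'
  set D := Real.log (Mb * Mk) - Real.log 2 * (entropy (powWeight w N)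
    (fun x => (F fun t => U (x t), fun t => Z (x t))) - entropy (powWeight w N) fun x t => Z (x t))
  -- The error probability and `D` are controlled only through their sum; since both are
  -- nonnegative, each is small. The factor `log 2` in the minimum converts nats to bits.
  have hD : 0 ≤ D := by
    have e1 := entropy_pair_le hw' (fun x => F fun t => U (x t)) fun x t => Z (x t)
    have e2 := entropy_le_logb_card hw' fun x => F fun t => U (x t)
    rw [Fintype.card_prod, Fintype.card_fin, Fintype.card_fin, Nat.cast_mul, Real.logb,
      le_div_iff₀ hl2] at e2
    simp only [D]
    nlinarith
  have hP := prob_nonneg hw' fun x => decode (powWeight w N) (fun x t => U (x t))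
    (fun x t => V (x t)) F (fun t => V (x t)) (F fun t => U (x t)).1 ≠ fun t => U (x t)
  refine ⟨F, fun v m => (F (decode (powWeight w N) (fun x t => U (x t))
    (fun x t => V (x t)) F v m)).2, ?_, ?_⟩
  · refine (prob_mono hw' fun x hx => ?_).trans_lt
      ((le_add_of_nonneg_right hD).trans_lt hF1)
    exact fun h => hx (congrArg (fun u => (F u).2) h)
  · have hD2 : D < ε * Real.log 2 := (le_add_of_nonneg_left hP).trans_lt hF2
    refine lt_of_mul_lt_mul_right (lt_of_eq_of_lt ?_ hD2) hl2.le
    simp only [D, Real.logb]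
    field_simp

/-- Secret keys from one source `U`: `V` helps to recover the key at any rate up to
`H(U | Z) - H(U | V)`, and all that is said together with the key is nearly uniform given `Z`. -/
theorem eventually_exists_key {w : A → ℝ} (hw : IsLaw w) (U : A → α) (V : A → β) (Z : A → γ)
    {R : ℝ} (hR : R = (entropy w (fun a => (U a, Z a)) - entropy w Z) -
      (entropy w (fun a => (U a, V a)) - entropy w V)) (hR0 : 0 ≤ R) {ε : ℝ} (hε : 0 < ε) :
    ∀ᶠ N : ℕ in atTop, ∃ Mb Mk : ℕ, 0 < Mb ∧ 0 < Mk ∧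
      ∃ (F : (Fin N → α) → Fin Mb × Fin Mk) (κ : (Fin N → β) → ℕ → Fin Mk),
        prob (powWeight w N) (fun x => κ (fun t => V (x t)) (F fun t => U (x t)).1 ≠
          (F fun t => U (x t)).2) < ε ∧
        Real.logb 2 (Mb * Mk) - (entropy (powWeight w N)
          (fun x => (F fun t => U (x t), fun t => Z (x t))) -
          entropy (powWeight w N) fun x t => Z (x t)) < ε ∧
        |Real.logb 2 Mk / N - R| < ε := by
  have hl2 : 0 < Real.log 2 := Real.log_pos one_lt_two
  -- At rate zero there is no room for the margins below, and trivial hashes and keys suffice.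
  rcases hR0.eq_or_lt with h0 | hRpos
  · refine Eventually.of_forall fun N => ⟨1, 1, one_pos, one_pos, fun _ => 0, fun _ _ => 0, ?_, ?_, ?_⟩
    · simpa [prob] using hε
    · rw [entropy_congr _ (V := fun x t => Z (x t)) (by simp)]
      simpa using hε
    · simpa [← h0] using hε
  set hV := Real.log 2 * (entropy w (fun a => (U a, V a)) - entropy w V)
  set hZ := Real.log 2 * (entropy w (fun a => (U a, Z a)) - entropy w Z)
  have hr : R * Real.log 2 = hZ - hV := by
    rw [hR]
    simp only [hV, hZ]
    ring
  have hV0 : 0 ≤ hV :=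
    mul_nonneg hl2.le (sub_nonneg.2 (entropy_mono hw fun a a' h => (Prod.mk.inj h).2))
  set δ := min R ε * Real.log 2 / 10
  have hm : 0 < min R ε := lt_min hRpos hε
  have hδ : 0 < δ := by positivity
  have hδR : 10 * δ ≤ R * Real.log 2 := by
    have := mul_le_mul_of_nonneg_right (min_le_left R ε) hl2.le
    simp only [δ]
    linarith
  have hδε : 10 * δ ≤ ε * Real.log 2 := by
    have := mul_le_mul_of_nonneg_right (min_le_right R ε) hl2.le
    simp only [δ]
    linarith
  have hlarge : ∀ᶠ N : ℕ in atTop, Real.log 2 ≤ N * δ :=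
    (tendsto_natCast_atTop_atTop.atTop_mul_const hδ).eventually_ge_atTop _
  filter_upwards [eventually_exists_hash hw U V Z hδ hε, hlarge, eventually_gt_atTop 0]
    with N hN hNδ hN0
  have hN0' : (0 : ℝ) < N := Nat.cast_pos.2 hN0
  have hexp2 : 2 ≤ Real.exp (N * δ) := by
    calc (2 : ℝ) = Real.exp (Real.log 2) := (Real.exp_log two_pos).symm
      _ ≤ _ := Real.exp_le_exp.2 hNδ
  set B := Real.exp (N * (hV + 2 * δ))
  -- The `5 * δ` consists of `2 * δ` for the bin rate, `2 * δ` for the margin below `hZ`, and `δ` to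
  -- absorb the factor 2 from rounding up `B`.
  set K := Real.exp (N * (hZ - hV - 5 * δ))
  have hB1 : 1 ≤ B := Real.one_le_exp (by positivity)
  have hK1 : 1 ≤ K := Real.one_le_exp (mul_nonneg hN0'.le (by linarith))
  have hMk : 0 < ⌊K⌋₊ := Nat.floor_pos.2 hK1
  have hMb : 0 < ⌈B⌉₊ := Nat.ceil_pos.2 (by linarith)
  have hb2 : (⌈B⌉₊ : ℝ) ≤ 2 * B := by
    have := Nat.ceil_lt_add_one (a := B) (by linarith)
    linarith
  have hk2 : (⌊K⌋₊ : ℝ) ≤ K := Nat.floor_le (by linarith)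
  have hk3 : K ≤ 2 * (⌊K⌋₊ : ℝ) := by
    have h1 := Nat.lt_floor_add_one K
    have h2 : (1 : ℝ) ≤ ⌊K⌋₊ := by exact_mod_cast hMk
    linarith
  have hprod : (⌈B⌉₊ : ℝ) * ⌊K⌋₊ ≤ Real.exp (N * (hZ - 2 * δ)) := by
    calc (⌈B⌉₊ : ℝ) * ⌊K⌋₊ ≤ 2 * B * K := mul_le_mul hb2 hk2 (by positivity) (by positivity)
      _ ≤ Real.exp (N * δ) * B * K := by gcongr
      _ = Real.exp (N * (hZ - 2 * δ)) := by
          simp only [B, K]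
          rw [← Real.exp_add, ← Real.exp_add]
          ring_nf
  obtain ⟨F, κ, h1, h2⟩ := hN ⌈B⌉₊ ⌊K⌋₊ hMb hMk (Nat.le_ceil _) hprod
  refine ⟨⌈B⌉₊, ⌊K⌋₊, hMb, hMk, F, κ, h1, h2, ?_⟩
  have hMk' : (0 : ℝ) < ⌊K⌋₊ := Nat.cast_pos.2 hMk
  have l1 : Real.log ⌊K⌋₊ ≤ N * (R * Real.log 2 - 5 * δ) := by
    have := Real.log_le_log hMk' hk2
    rw [Real.log_exp] at this
    rw [hr]
    exact this
  have l2 : N * (R * Real.log 2 - 5 * δ) ≤ Real.log 2 + Real.log ⌊K⌋₊ := by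
    have := Real.log_le_log (by linarith) hk3
    rw [Real.log_exp, Real.log_mul two_ne_zero hMk'.ne'] at this
    rw [hr]
    exact this
  have e : Real.logb 2 ⌊K⌋₊ / N - R = (Real.log ⌊K⌋₊ - N * (R * Real.log 2)) / (N * Real.log 2) := by
    rw [Real.logb]
    field_simp
  rw [e, abs_div, abs_of_pos (mul_pos hN0' hl2), div_lt_iff₀ (mul_pos hN0' hl2), abs_lt]
  constructor <;> nlinarith

end Blocks

/-! ### Achievability -/

section Achievability

set_option linter.unusedSectionVars false

variable {ι : Type*} [Fintype ι] [DecidableEq ι] {X : ι → Type*} [∀ i, Fintype (X i)]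
  {X₀ : Type*} [Fintype X₀]

/-- The elements of `S` can be added to `C` one after the other. -/
theorem exists_telescope (S C : Finset ι) (h : Disjoint S C) :
    ∃ T : ι → Finset ι, (∀ i ∈ S, i ∉ T i) ∧ ∀ f : Finset ι → ℝ,
      ∑ i ∈ S, (f (insert i (T i)) - f (T i)) = f (S ∪ C) - f C := by
  induction S using Finset.induction_on with
  | empty => exact ⟨fun _ => ∅, by simp, by simp⟩
  | insert a S ha ih =>
    rw [Finset.disjoint_insert_left] at h
    obtain ⟨T, hT, hf⟩ := ih h.2
    have hne : ∀ i ∈ S, i ≠ a := fun i hi hia => ha (hia ▸ hi)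
    refine ⟨Function.update T a (S ∪ C), fun i hi => ?_, fun f => ?_⟩
    · rcases Finset.mem_insert.1 hi with rfl | hi
      · simp [ha, h.1]
      · rw [Function.update_of_ne (hne i hi)]
        exact hT i hi
    · rw [Finset.sum_insert ha, Function.update_self, Finset.insert_union,
        Finset.sum_congr rfl fun i hi => by rw [Function.update_of_ne (hne i hi)], hf]
      ring

namespace BlockStrategy

variable {S : Finset ι} {N : ℕ}

/-- Every agent of the coalition hashes its observation, says the first part of the hash and keeps
the second part as its key. -/
def ofHash {Mb Mk : S → ℕ} (hk : ∀ i, 0 < Mk i)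
    (F : ∀ i : S, (Fin N → X i) → Fin (Mb i) × Fin (Mk i))
    (κ : ∀ i : S, (Fin N → X₀) → ℕ → Fin (Mk i)) : BlockStrategy X X₀ S N where
  keySize := Mk
  keySize_pos := hk
  seeds := 1
  seedLaw _ := PMF.pure 0
  rounds := 1
  agentMsg i x _ _ := (F i x).1
  baseMsg _ _ _ := 0
  key i x _ := (F i x).2
  baseKey i x h := κ i x (h.headD (fun _ => 0) (some (i : ι)))

theorem mapsLaw_weight_fst (p : PMF (Symbol X X₀)) (a : BlockStrategy X X₀ S N) :
    MapsLaw (a.weight p) Prod.fst (powWeight (sourceWeight p) N) :=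
  mapsLaw_fst (powWeight (sourceWeight p) N) a.isLaw_seedWeight

/-! ### Reliability and secrecy of the hashing protocol -/

section OfHash

variable {Mb Mk : S → ℕ} (hk : ∀ i, 0 < Mk i)
  (F : ∀ i : S, (Fin N → X i) → Fin (Mb i) × Fin (Mk i))
  (κ : ∀ i : S, (Fin N → X₀) → ℕ → Fin (Mk i))

theorem errorProb_ofHash_le (p : PMF (Symbol X X₀)) :
    (ofHash hk F κ).errorProb p ≤ ∑ i : S, prob (powWeight (sourceWeight p) N) fun x =>
      κ i (baseObs x) (F i (agentObs x i)).1 ≠ (F i (agentObs x i)).2 := by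
  have hw := (isLaw_sourceWeight p).pow N
  refine le_trans (le_of_eq ?_) (prob_exists_le hw _)
  rw [errorProb, ← ((ofHash hk F κ).mapsLaw_weight_fst p).prob_comp]
  refine prob_congr _ fun ω => ?_
  rw [Ne, funext_iff, not_forall]
  refine exists_congr fun i => not_congr ?_
  have h : ((ofHash hk F κ).publicComm ω.1 ω.2).headD (fun _ => 0) (some (i : ι)) =
      (F i (agentObs ω.1 i)).1 := by
    change (ofHash hk F κ).nextRound true ω.1 ω.2 [] (some (i : ι)) = _
    rw [nextRound, dif_pos i.2]
    rfl
  change κ i (baseObs ω.1) (((ofHash hk F κ).publicComm ω.1 ω.2).headD (fun _ => 0)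
    (some (i : ι))) = _ ↔ _
  rw [h]
  rfl

theorem publicComm_ofHash_eq_iff {x y : Fin N → Symbol X X₀}
    {q r : Option ι → Fin (ofHash hk F κ).seeds} :
    (ofHash hk F κ).publicComm x q = (ofHash hk F κ).publicComm y r ↔
      ∀ i : S, (F i (agentObs x i)).1 = (F i (agentObs y i)).1 := by
  have h1 : ∀ x q, (ofHash hk F κ).publicComm x q =
      [(ofHash hk F κ).nextRound true x q []] := fun _ _ => rfl
  have h2 : ∀ x q, ∀ i : S, (ofHash hk F κ).nextRound true x q [] (some (i : ι)) =
      (F i (agentObs x i)).1 := fun x q i => by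
    rw [nextRound, dif_pos i.2]
    rfl
  rw [h1, h1]
  constructor
  · intro h i
    have := congrFun (List.cons_eq_cons.1 h).1 (some (i : ι))
    rw [h2, h2] at this
    exact Fin.val_injective this
  · intro h
    refine List.cons_eq_cons.2 ⟨funext fun j => ?_, rfl⟩
    cases j with
    | none => rfl
    | some i =>
      by_cases hi : i ∈ S
      · rw [h2 x q ⟨i, hi⟩, h2 y r ⟨i, hi⟩, h]
      · rw [nextRound, nextRound, dif_neg hi, dif_neg hi]

/-- Inside the coalition the hash of an observation, outside the observation. -/
def hashOrObs (i : ι) (x : Fin N → X i) : (Fin N → X i) ⊕ (ℕ × ℕ) :=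
  if h : i ∈ S then .inr ((F ⟨i, h⟩ x).1, (F ⟨i, h⟩ x).2) else .inl x

theorem hashOrObs_eq_iff_of_mem (i : S) {x y : Fin N → X i} :
    hashOrObs F i x = hashOrObs F i y ↔ F i x = F i y := by
  simp [hashOrObs, i.2, Prod.ext_iff, Fin.val_inj]

theorem hashOrObs_eq_iff_of_notMem {i : ι} (hi : i ∉ S) {x y : Fin N → X i} :
    hashOrObs F i x = hashOrObs F i y ↔ x = y := by
  simp [hashOrObs, hi]

/-- The chain rule for `H(K, A | X_{Sᶜ})` along the sets `T i`. Conditioning on the observations of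
`T i`, not merely on the hashes of its members in `S`, only lowers each term, and `H(A)` is at most
the total length of the bins. -/
theorem leakage_add_uniformityGap_ofHash_le (p : PMF (Symbol X X₀)) (hb : ∀ i, 0 < Mb i)
    {T : ι → Finset ι} (hT : ∀ f : Finset ι → ℝ,
      ∑ i ∈ S, (f (insert i (T i)) - f (T i)) = f Finset.univ - f Sᶜ) :
    (ofHash hk F κ).leakage p + (ofHash hk F κ).uniformityGap p ≤
      ∑ i : S, (Real.logb 2 (Mb i * Mk i) - (entropy (powWeight (sourceWeight p) N)
        (fun x => (F i (agentObs x i), fun t => agentsPart (T i) (x t))) -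
        entropy (powWeight (sourceWeight p) N) fun x t => agentsPart (T i) (x t))) := by
  set a := ofHash hk F κ
  have hw := (isLaw_sourceWeight p).pow N
  have hwa := a.isLaw_weight p
  set G : ∀ T : Finset ι, (Fin N → Symbol X X₀) → ∀ i : T, (Fin N → X i) ⊕ (ℕ × ℕ) :=
    fun T x i => hashOrObs F i (agentObs x i)
  have hG : ∀ {T : Finset ι} {x y : Fin N → Symbol X X₀}, G T x = G T y ↔
      ∀ i ∈ T, hashOrObs F i (agentObs x i) = hashOrObs F i (agentObs y i) := by
    intro T x y
    simp [G, funext_iff]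
  set f := fun T => entropy (powWeight (sourceWeight p) N) (G T)
  have hpart : ∀ {T : Finset ι} {x y : Fin N → Symbol X X₀}, ((fun t => agentsPart T (x t)) =
      fun t => agentsPart T (y t)) ↔ ∀ i ∈ T, agentObs x i = agentObs y i := by
    intro T x y
    rw [funext_iff]
    simp only [agentsPart_eq_iff, agentObs_eq_iff]
    exact ⟨fun h i hi t => h t i hi, fun h t i hi => h i hi t⟩
  have hstep : ∀ i : S, entropy (powWeight (sourceWeight p) N)
      (fun x => (F i (agentObs x i), fun t => agentsPart (T i) (x t))) -
      entropy (powWeight (sourceWeight p) N) (fun x t => agentsPart (T i) (x t)) ≤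
      f (insert (i : ι) (T i)) - f (T i) := by
    intro i
    have h := entropy_submodular hw (fun x => F i (agentObs x i))
      (fun x t => agentsPart (T i) (x t)) (G (T i))
    have hGT : ∀ x y : Fin N → Symbol X X₀, ((fun t => agentsPart (T i) (x t)) =
        fun t => agentsPart (T i) (y t)) → G (T i) x = G (T i) y := by
      intro x y hxy
      rw [hpart] at hxy
      rw [hG]
      intro j hj
      rw [hxy j hj]
    have h1 := entropy_congr (powWeight (sourceWeight p) N)
      (U := fun x => (F i (agentObs x i), (fun t => agentsPart (T i) (x t)), G (T i) x))
      (V := fun x => (F i (agentObs x i), fun t => agentsPart (T i) (x t))) (by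
        intro x y
        have := hGT x y
        simp only [Prod.mk.injEq]; tauto)
    have h2 := entropy_congr (powWeight (sourceWeight p) N)
      (U := fun x => ((fun t => agentsPart (T i) (x t)), G (T i) x))
      (V := fun x t => agentsPart (T i) (x t)) (by
        intro x y
        have := hGT x y
        simp only [Prod.mk.injEq]; tauto)
    have h3 := entropy_congr (powWeight (sourceWeight p) N)
      (U := fun x => (F i (agentObs x i), G (T i) x)) (V := G (insert (i : ι) (T i))) (by
        intro x y
        rw [Prod.mk.injEq, hG, hG, Finset.forall_mem_insert, hashOrObs_eq_iff_of_mem])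
    simp only [f]
    linarith
  have hsum : ∑ i : S, (f (insert (i : ι) (T i)) - f (T i)) = f Finset.univ - f Sᶜ := by
    rw [← hT f]
    exact Finset.sum_coe_sort S fun i => f (insert i (T i)) - f (T i)
  have hm := a.mapsLaw_weight_fst p
  have e1 : entropy (a.weight p) (fun ω => outsideObs S ω.1) = f Sᶜ := by
    rw [hm.entropy_comp fun x => outsideObs S x]
    refine entropy_congr _ fun x y => ?_
    rw [outsideObs_eq_iff, hG]
    refine forall₂_congr fun i hi => ?_
    rw [hashOrObs_eq_iff_of_notMem F (Finset.mem_compl.1 hi)]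
  have e2 : entropy (a.weight p) (fun ω =>
      (a.keys ω.1 ω.2, a.publicComm ω.1 ω.2, outsideObs S ω.1)) = f Finset.univ := by
    refine Eq.trans (entropy_congr _ fun ω ω' => ?_) (hm.entropy_comp (G Finset.univ))
    rw [Prod.mk.injEq, Prod.mk.injEq, outsideObs_eq_iff, hG, publicComm_ofHash_eq_iff,
      show a.keys ω.1 ω.2 = a.keys ω'.1 ω'.2 ↔
        ∀ i : S, (F i (agentObs ω.1 i)).2 = (F i (agentObs ω'.1 i)).2 from funext_iff]
    constructor
    · rintro ⟨h1, h2, h3⟩ i -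
      by_cases hi : i ∈ S
      · exact (hashOrObs_eq_iff_of_mem F ⟨i, hi⟩).2 (Prod.ext (h2 ⟨i, hi⟩) (h1 ⟨i, hi⟩))
      · rw [h3 i (Finset.mem_compl.2 hi)]
    · intro h
      have h' : ∀ i : S, F i (agentObs ω.1 i) = F i (agentObs ω'.1 i) := fun i =>
        (hashOrObs_eq_iff_of_mem F i).1 (h i (Finset.mem_univ _))
      exact ⟨fun i => by rw [h'], fun i => by rw [h'], fun i hi =>
        (hashOrObs_eq_iff_of_notMem F (Finset.mem_compl.1 hi)).1 (h i (Finset.mem_univ _))⟩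
  have e3 : entropy (a.weight p) (fun ω => (a.publicComm ω.1 ω.2, outsideObs S ω.1)) ≤
      ∑ i : S, Real.logb 2 (Mb i) + f Sᶜ := by
    refine (entropy_pair_le hwa (fun ω => a.publicComm ω.1 ω.2) fun ω => outsideObs S ω.1).trans ?_
    rw [e1]
    refine add_le_add_left ?_ _
    rw [entropy_congr (a.weight p) (V := fun ω (i : S) => (F i (agentObs ω.1 i)).1) (by
      intro ω ω'
      rw [publicComm_ofHash_eq_iff, funext_iff])]
    refine (entropy_le_logb_card hwa _).trans_eq ?_
    rw [Fintype.card_pi, Nat.cast_prod, Real.logb_prod]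
    · simp
    · intro i _
      simpa using (hb i).ne'
  rw [leakage_add_uniformityGap, e2, logKeys_eq_sum, Finset.sum_sub_distrib]
  have h1 := Finset.sum_le_sum fun i (_ : i ∈ Finset.univ) => hstep i
  have h2 : ∑ i : S, Real.logb 2 (Mb i * Mk i) =
      ∑ i : S, Real.logb 2 (Mb i) + ∑ i : S, Real.logb 2 (a.keySize i) := by
    rw [← Finset.sum_add_distrib]
    refine Finset.sum_congr rfl fun i _ => ?_
    exact Real.logb_mul (Nat.cast_ne_zero.2 (hb i).ne') (Nat.cast_ne_zero.2 (hk i).ne')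
  rw [h2]
  linarith

end OfHash

/-- How far `a` is from a strategy that gives perfect secret keys of rates `R`. -/
def defect (p : PMF (Symbol X X₀)) (R : S → ℝ) (a : BlockStrategy X X₀ S N) : ℝ :=
  a.errorProb p + (a.leakage p + a.uniformityGap p) +
    ∑ i, |Real.logb 2 (a.keySize i) / N - R i|

theorem defect_nonneg (p : PMF (Symbol X X₀)) (R : S → ℝ) (a : BlockStrategy X X₀ S N) :
    0 ≤ a.defect p R :=
  add_nonneg (add_nonneg (a.errorProb_nonneg p)
    (add_nonneg (a.leakage_nonneg p) (a.uniformityGap_nonneg p)))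
    (Finset.sum_nonneg fun _ _ => abs_nonneg _)

end BlockStrategy

/-- The rates are the successive informations $I(X_i;X_0\mid X_{T_i})$, independent of block length
and tolerance. -/
theorem exists_rates (p : PMF (Symbol X X₀)) (hp : MarkovSource p) (S : Finset ι) :
    ∃ R : S → ℝ, ∑ i, R i = sourceInfo p S ∧ ∀ ε > 0, ∀ᶠ N in atTop,
      ∃ a : BlockStrategy X X₀ S N, a.defect p R < ε := by
  have hw := isLaw_sourceWeight p
  -- The same ordering telescopes three set functions: the entropies `f₁` and `f₂` of the source and
  -- the entropy of the hashed blocks in the leakage bound.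
  obtain ⟨T, hTi, hT⟩ := exists_telescope S Sᶜ disjoint_compl_right
  simp only [Finset.union_compl] at hT
  set R : S → ℝ := fun i =>
    (entropy (sourceWeight p) (fun x => (x.1 (i : ι), agentsPart (T i) x)) -
      entropy (sourceWeight p) (agentsPart (T i))) -
    (entropy (sourceWeight p) (fun x => (x.1 (i : ι), x.2)) -
      entropy (sourceWeight p) fun x => x.2)
  set f₁ : Finset ι → ℝ := fun T => entropy (sourceWeight p) (agentsPart T)
  set f₂ : Finset ι → ℝ := fun T => entropy (sourceWeight p) fun x => (agentsPart T x, x.2)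
  have e1 : ∀ i : S, entropy (sourceWeight p) (fun x => (x.1 (i : ι), agentsPart (T i) x)) =
      f₁ (insert (i : ι) (T i)) := fun i => entropy_congr _ fun x y => by
    rw [Prod.mk.injEq, agentsPart_eq_iff, agentsPart_eq_iff, Finset.forall_mem_insert]
  have e2 : ∀ i : S, entropy (sourceWeight p) (fun x => (x.1 (i : ι), agentsPart (T i) x, x.2)) =
      f₂ (insert (i : ι) (T i)) := fun i => entropy_congr _ fun x y => by
    rw [Prod.mk.injEq, Prod.mk.injEq, Prod.mk.injEq, agentsPart_eq_iff, agentsPart_eq_iff,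
      Finset.forall_mem_insert, and_assoc]
  -- By the Markov chain for `{i}` and `T i`, further conditioning on `T i` leaves `H(X_i | X_0)`
  -- unchanged.
  have e3 : ∀ i : S, entropy (sourceWeight p) (fun x => (x.1 (i : ι), x.2)) -
      entropy (sourceWeight p) (fun x => x.2) = f₂ (insert (i : ι) (T i)) - f₂ (T i) := by
    intro i
    have h := condMutualInfo_eq_zero hw
      (hp {(i : ι)} (T i) (Finset.disjoint_singleton_left.2 (hTi i i.2)))
    rw [condMutualInfo, entropy_congr _ (V := fun x => (x.1 (i : ι), x.2)) (by
        intro x y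
        rw [Prod.mk.injEq, Prod.mk.injEq, agentsPart_eq_iff]
        simp),
      entropy_congr _ (U := fun x => (agentsPart {(i : ι)} x, agentsPart (T i) x, x.2))
        (V := fun x => (x.1 (i : ι), agentsPart (T i) x, x.2)) (by
        intro x y
        simp only [Prod.mk.injEq, agentsPart_eq_iff, Finset.mem_singleton, forall_eq]), e2] at h
    simp only [f₂] at h ⊢
    linarith
  have hR0 : ∀ i, 0 ≤ R i := by
    intro i
    have h := entropy_submodular hw (fun x => x.1 (i : ι)) (fun x => x.2) (agentsPart (T i))
    have h2 := e3 i
    rw [← e2] at h2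
    rw [entropy_congr _ (V := fun x => (x.1 (i : ι), agentsPart (T i) x, x.2)) (by
        intro x y
        simp only [Prod.mk.injEq]; tauto),
      entropy_congr _ (U := fun x => (x.2, agentsPart (T i) x))
        (V := fun x => (agentsPart (T i) x, x.2)) (by
        intro x y
        simp only [Prod.mk.injEq]; tauto)] at h
    simp only [R, f₂] at h2 ⊢
    linarith
  refine ⟨R, ?_, fun ε hε => ?_⟩
  · have h1 : ∑ i : S, (f₁ (insert (i : ι) (T i)) - f₁ (T i)) = _ :=
      (Finset.sum_coe_sort S fun i => f₁ (insert i (T i)) - f₁ (T i)).trans (hT f₁)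
    have h2 : ∑ i : S, (f₂ (insert (i : ι) (T i)) - f₂ (T i)) = _ :=
      (Finset.sum_coe_sort S fun i => f₂ (insert i (T i)) - f₂ (T i)).trans (hT f₂)
    simp only [R, e1, e3]
    rw [Finset.sum_sub_distrib, h1, h2, sourceInfo, condMutualInfo]
    have hU : ∀ x y : Symbol X X₀, agentsPart Finset.univ x = agentsPart Finset.univ y ↔
        agentsPart S x = agentsPart S y ∧ agentsPart Sᶜ x = agentsPart Sᶜ y := by
      intro x y
      simp only [agentsPart_eq_iff, Finset.mem_univ, forall_true_left, Finset.mem_compl]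
      exact ⟨fun h => ⟨fun i _ => h i, fun i _ => h i⟩, fun h i =>
        (em (i ∈ S)).elim (h.1 i) (h.2 i)⟩
    rw [entropy_congr _ (V := agentsPart Finset.univ) (by
        intro x y
        rw [hU, Prod.mk.injEq]),
      entropy_congr _ (U := fun x => (x.2, agentsPart Sᶜ x))
        (V := fun x => (agentsPart Sᶜ x, x.2)) (by
        intro x y
        simp only [Prod.mk.injEq]; tauto),
      entropy_congr _ (U := fun x => (agentsPart S x, x.2, agentsPart Sᶜ x))
        (V := fun x => (agentsPart Finset.univ x, x.2)) (by
        intro x y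
        simp only [Prod.mk.injEq, hU]; tauto)]
    simp only [f₁, f₂]
    ring
  -- Error, secrecy and rate deviation each contribute `|S|` terms; the extra 1 keeps the bound
  -- strict and covers empty `S`.
  · set c : ℝ := 3 * Fintype.card S + 1
    have hc : 0 < c := by positivity
    have hev := eventually_all.2 fun i : S => eventually_exists_key hw (fun x => x.1 (i : ι))
      (fun x => x.2) (agentsPart (T i)) (R := R i) rfl (hR0 i) (div_pos hε hc)
    filter_upwards [hev] with N hN
    choose Mb Mk hb hk F κ h1 h2 h3 using hN
    refine ⟨BlockStrategy.ofHash hk F κ, ?_⟩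
    have b1 := (BlockStrategy.errorProb_ofHash_le hk F κ p).trans
      (Finset.sum_le_sum fun i _ => (h1 i).le)
    have b2 := (BlockStrategy.leakage_add_uniformityGap_ofHash_le hk F κ p hb hT).trans
      (Finset.sum_le_sum fun i _ => (h2 i).le)
    have b3 : ∑ i, |Real.logb 2 ((BlockStrategy.ofHash hk F κ).keySize i) / N - R i| ≤ _ :=
      Finset.sum_le_sum fun i _ => (h3 i).le
    rw [Finset.sum_const, Finset.card_univ, nsmul_eq_mul] at b1 b2 b3
    calc (BlockStrategy.ofHash hk F κ).defect p R
        ≤ Fintype.card S * (ε / c) + Fintype.card S * (ε / c) + Fintype.card S * (ε / c) :=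
          add_le_add (add_le_add b1 b2) b3
      _ < c * (ε / c) := by
          have := div_pos hε hc
          simp only [c] at this ⊢
          nlinarith
      _ = ε := mul_div_cancel₀ _ hc.ne'

/-- The sum-rate `I(X_S; X_0 | X_{Sᶜ})` is achievable. -/
theorem exists_strategy (p : PMF (Symbol X X₀)) (hp : MarkovSource p) (S : Finset ι) :
    ∃ a : Strategy X X₀ S, ∑ i, a.rate i = sourceInfo p S ∧
      Tendsto (fun N => (a.block N).errorProb p) atTop (𝓝 0) ∧
      Tendsto (fun N => (a.block N).leakage p) atTop (𝓝 0) ∧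
      Tendsto (fun N => (a.block N).uniformityGap p) atTop (𝓝 0) := by
  obtain ⟨R, hR, h⟩ := exists_rates p hp S
  have hne : ∀ N, Nonempty (BlockStrategy X X₀ S N) := fun N => ⟨BlockStrategy.reveal X X₀ S N⟩
  have hbdd : ∀ N, BddBelow (Set.range fun a : BlockStrategy X X₀ S N => a.defect p R) :=
    fun N => ⟨0, by
      rintro _ ⟨a, rfl⟩
      exact a.defect_nonneg p R⟩
  -- A near-minimiser of the defect at every `N` gives one sequence that works for every tolerance,
  -- with no diagonal argument.
  have hex : ∀ N : ℕ, ∃ a : BlockStrategy X X₀ S N, a.defect p R <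
      (⨅ a : BlockStrategy X X₀ S N, a.defect p R) + 1 / ((N : ℝ) + 1) := fun N =>
    exists_lt_of_ciInf_lt (lt_add_of_pos_right _ Nat.one_div_pos_of_nat)
  choose a ha using hex
  have hlim : Tendsto (fun N => (a N).defect p R) atTop (𝓝 0) := by
    refine tendsto_order.2 ⟨fun ε hε => Eventually.of_forall fun N =>
      hε.trans_le ((a N).defect_nonneg p R), fun ε hε => ?_⟩
    filter_upwards [h (ε / 2) (half_pos hε),
      (tendsto_one_div_add_atTop_nhds_zero_nat (𝕜 := ℝ)).eventually_lt_const (half_pos hε)]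
      with N hN1 hN2
    obtain ⟨b, hb⟩ := hN1
    have := ciInf_le (hbdd N) b
    linarith [ha N]
  have hsum : ∀ N, 0 ≤ ∑ i, |Real.logb 2 ((a N).keySize i) / N - R i| := fun N =>
    Finset.sum_nonneg fun _ _ => abs_nonneg _
  refine ⟨⟨a, R, fun i => ?_⟩, hR, ?_, ?_, ?_⟩
  · rw [tendsto_iff_norm_sub_tendsto_zero]
    refine squeeze_zero (fun _ => norm_nonneg _) (fun N => ?_) hlim
    have h1 := Finset.single_le_sum (f := fun i => |Real.logb 2 ((a N).keySize i) / N - R i|)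
      (fun _ _ => abs_nonneg _) (Finset.mem_univ i)
    have h2 := (a N).errorProb_nonneg p
    have h3 := (a N).leakage_nonneg p
    have h4 := (a N).uniformityGap_nonneg p
    rw [BlockStrategy.defect, Real.norm_eq_abs]
    linarith
  all_goals
    refine squeeze_zero (fun N => ?_) (fun N => ?_) hlim
  · exact (a N).errorProb_nonneg p
  · have h3 := (a N).leakage_nonneg p
    have h4 := (a N).uniformityGap_nonneg p
    have h5 := hsum N
    rw [BlockStrategy.defect]
    linarith
  · exact (a N).leakage_nonneg p
  · have h2 := (a N).errorProb_nonneg p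
    have h4 := (a N).uniformityGap_nonneg p
    have h5 := hsum N
    rw [BlockStrategy.defect]
    linarith
  · exact (a N).uniformityGap_nonneg p
  · have h2 := (a N).errorProb_nonneg p
    have h3 := (a N).leakage_nonneg p
    have h5 := hsum N
    rw [BlockStrategy.defect]
    linarith

/-! ### The game -/

open Classical in
theorem sum_payoff (p : PMF (Symbol X X₀)) {S : Finset ι} (a : Strategy X X₀ S)
    (b : Strategy X X₀ Sᶜ) :
    ∑ i, payoff p a b i = if GivesSecretKeys p a b then ∑ i, a.rate i else 0 := by
  simp only [payoff]
  split_ifs <;> simp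

theorem isLeast_guaranteed (p : PMF (Symbol X X₀)) {S : Finset ι} (a : Strategy X X₀ S) :
    IsLeast (Set.range fun b : Strategy X X₀ Sᶜ => ∑ i, payoff p a b i) (guaranteed p a) := by
  classical
  have hfin : (Set.range fun b : Strategy X X₀ Sᶜ => ∑ i, payoff p a b i).Finite := by
    refine (Set.toFinite {∑ i, a.rate i, 0}).subset ?_
    rintro _ ⟨b, rfl⟩
    simp only [sum_payoff]
    split_ifs <;> simp
  have hne : (Set.range fun b : Strategy X X₀ Sᶜ => ∑ i, payoff p a b i).Nonempty :=
    ⟨_, Strategy.reveal X X₀ Sᶜ, rfl⟩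
  exact ⟨hne.csInf_mem hfin, fun r hr => csInf_le hfin.bddBelow hr⟩

/-- Against opponents who reveal everything, either the payoffs vanish, or secrecy in the game is
secrecy from the outside observations and the converse applies. -/
theorem guaranteed_le (p : PMF (Symbol X X₀)) {S : Finset ι} (a : Strategy X X₀ S) :
    guaranteed p a ≤ sourceInfo p S := by
  refine ((isLeast_guaranteed p a).2 ⟨Strategy.reveal X X₀ Sᶜ, rfl⟩).trans ?_
  simp only [sum_payoff]
  split_ifs with h
  · refine sum_rate_le p a h.1 ?_ h.2.2
    simpa only [Strategy.reveal, BlockStrategy.jointLeakage_reveal] using h.2.1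
  · exact sourceInfo_nonneg p S

/-- Secrecy from the outside observations implies secrecy against every opponent, so the payoff sum
is the same for all of them. -/
theorem guaranteed_eq_sum_rate (p : PMF (Symbol X X₀)) {S : Finset ι} (a : Strategy X X₀ S)
    (he : Tendsto (fun N => (a.block N).errorProb p) atTop (𝓝 0))
    (hl : Tendsto (fun N => (a.block N).leakage p) atTop (𝓝 0))
    (hu : Tendsto (fun N => (a.block N).uniformityGap p) atTop (𝓝 0)) :
    guaranteed p a = ∑ i, a.rate i := by
  obtain ⟨b, hb⟩ := (isLeast_guaranteed p a).1
  rw [← hb]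
  simp only [sum_payoff]
  exact if_pos ⟨he, squeeze_zero (fun N => (a.block N).jointLeakage_nonneg p (b.block N))
    (fun N => (a.block N).jointLeakage_le_leakage p (b.block N)) hl, hu⟩

end Achievability

end SecretKeyGame

end

open SecretKeyGame in
theorem theorem1 {ι : Type*} [Fintype ι] [DecidableEq ι] {X : ι → Type*} [∀ i, Fintype (X i)]
    {X₀ : Type*} [Fintype X₀] (p : PMF (Symbol X X₀)) (hp : MarkovSource p) (S : Finset ι) :
    (∀ a : Strategy X X₀ S,
      IsLeast (Set.range fun b : Strategy X X₀ Sᶜ => ∑ i, payoff p a b i) (guaranteed p a)) ∧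
    IsGreatest (Set.range fun a : Strategy X X₀ S => guaranteed p a) (sourceInfo p S) ∧
    value p S = sourceInfo p S ∧
    IsGreatest {r : ℝ | ∃ R : S → ℝ, Achievable p S R ∧ r = ∑ i, R i} (sourceInfo p S) := by
  obtain ⟨a, hr, he, hl, hu⟩ := exists_strategy p hp S
  have hg : IsGreatest (Set.range fun a : Strategy X X₀ S => guaranteed p a) (sourceInfo p S) := by
    refine ⟨⟨a, (guaranteed_eq_sum_rate p a he hl hu).trans hr⟩, ?_⟩
    rintro _ ⟨b, rfl⟩
    exact guaranteed_le p b
  refine ⟨isLeast_guaranteed p, hg, hg.csSup_eq, ⟨a.rate, ⟨a, rfl, he, hl, hu⟩, hr.symm⟩, ?_⟩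
  rintro _ ⟨_, ⟨b, rfl, he, hl, hu⟩, rfl⟩
  exact sum_rate_le p b he hl hu
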